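/- Let $m\ge 2$ and let $M^m$ be a connected oriented smooth Riemannian $m$-manifold with Levi-Civita connection $\nabla$. Let $I\subset\mathbb R$ be an interval with more than one point. A smooth curve $\gamma:I\to M$ is a *Frenet curve* if $\gamma',\nabla_{\gamma'}\gamma',\dots,\nabla_{\gamma'}^{m-1}\gamma'$ are linearly independent at every point of $I$. If it is parametrized by arc length, its Frenet frame $T=X_1=\gamma'$, $N=X_2$, $B_i=X_{i+2}$ $(1\le i\le m-2)$ and curvatures $\kappa_1,\dots,\kappa_{m-1}:I\to\mathbb R$ are the smooth positively oriented orthonormal frame along $\gamma$ and the smooth functions with $\kappa_i>0$ for $i\le m-2$ and $\nabla_TX_1=\kappa_1X_2$, $\nabla_TX_i=-\kappa_{i-1}X_{i-1}+\kappa_iX_{i+1}$ $(2\le i\le m-1)$, $\nabla_TX_m=-\kappa_{m-1}X_{m-1}$. Let $\mathcal V$ be a vector field along $\gamma$. The curve $\gamma$ is a *PA curve with $(\mathcal V,\theta)$* if $\gamma$ is a Frenet curve parametrized by arc length, $\mathcal V$ is smooth of unit length, $\theta:I\to[0,\pi]$ is smooth, and $\theta$ is the angle between $\mathcal V$ and $N$.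 The field $\mathcal V$ is *torse-forming along $\gamma$ with potential function $f$ and generating form $\omega$* if $\mathcal V$, $f$ and $\omega(T)$ are smooth along $\gamma$ and $\nabla_T\mathcal V=fT+\omega(T)\mathcal V$; here $\omega$ is a family of linear forms $\omega_s:T_{\gamma(s)}M\to\mathbb R$. For functions $f,\theta,\lambda_0,\dots,\lambda_{m-2},\kappa_1,\dots,\kappa_{m-1}$ on an interval consider the normalization $$1=\cos^2\theta+\sum_{i=0}^{m-2}\lambda_i^2\tag{1}$$ and the system $$\begin{aligned} & f(1-\lambda_0^2)-\lambda_0'+\kappa_1\cos\theta=0,\\ & -f\lambda_0\cos\theta+\theta'\sin\theta-\lambda_0\kappa_1+\lambda_1\kappa_2=0,\\ & -f\lambda_0\lambda_1-\lambda_1'+\lambda_2\kappa_3-\kappa_2\cos\theta=0,\\ & -f\lambda_0\lambda_i-\lambda_i'-\lambda_{i-1}\kappa_{i+1}+\lambda_{i+1}\kappa_{i+2}=0\quad(2\le i\le m-3),\\ & -f\lambda_0\lambda_{m-2}-\lambda_{m-2}'-\lambda_{m-3}\kappa_{m-1}=0, \end{aligned}\tag{2}$$ where the third equation is present only for $m\ge3$,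 the last one only for $m\ge4$, and terms containing $\lambda_i$ with $i>m-2$ are omitted. **(a)** Let $\gamma:I\to M$ be a Frenet curve parametrized by arc length, with Frenet frame and curvatures as above, let $\mathcal V$ be a vector field along $\gamma$, $f:I\to\mathbb R$ a smooth function, $\omega$ a family of linear forms along $\gamma$, and $\theta$ a real function on $I$. Then $\gamma$ is a PA curve with $(\mathcal V,\theta)$ and $\mathcal V$ is torse-forming along $\gamma$ with potential function $f$ and generating form $\omega$ if and only if $\theta$ is smooth with values in $[0,\pi]$ and there are smooth functions $\lambda_0,\dots,\lambda_{m-2}$ on $I$ such that $\mathcal V=\lambda_0T+\cos\theta\,N+\sum_{i=1}^{m-2}\lambda_iB_i$, (1) and (2) hold on $I$, and $\omega(T)=-f\langle\mathcal V,T\rangle$. **(b)** Let $f$, $\theta$, $\lambda_0,\dots,\lambda_{m-2}$, $\kappa_1,\dots,\kappa_{m-1}$ be smooth functions on $(s_0-\delta,s_0+\delta)$, $\delta>0$, with $\theta\in[0,\pi]$, $\kappa_i>0$ for $i\le m-2$ and $\kappa_{m-1}$ nowhere zero, which satisfy (1) and (2). Let $p_0\in M$ and let $(e_1,\dots,e_m)$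 be a positively oriented orthonormal basis of $T_{p_0}M$. Then there are $0<\varepsilon\le\delta$ and a Frenet curve $\gamma:(s_0-\varepsilon,s_0+\varepsilon)\to M$ parametrized by arc length, with $\gamma(s_0)=p_0$, with curvatures $\kappa_1,\dots,\kappa_{m-1}$ and with Frenet frame equal to $(e_1,\dots,e_m)$ at $s_0$, such that, for $\mathcal V=\lambda_0T+\cos\theta\,N+\sum_{i=1}^{m-2}\lambda_iB_i$, the curve $\gamma$ is a PA curve with $(\mathcal V,\theta)$, and $\mathcal V$ is torse-forming along $\gamma$ with potential function $f$ and generating form $\omega$ for every family $\omega$ of linear forms along $\gamma$ with $\omega(T)=-f\langle\mathcal V,T\rangle$. -/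

import Mathlib

open Set Filter Topology Manifold Bundle
open scoped ContDiff

noncomputable section

/-- The model space `ℝ^m`, with its Euclidean structure. -/
abbrev Model (m : ℕ) : Type := EuclideanSpace ℝ (Fin m)

/-- The tangent space `T_p M` of an `m`-manifold. -/
abbrev Tan {m : ℕ} {M : Type*} [TopologicalSpace M] [ChartedSpace (Model m) M] (p : M) : Type :=
  TangentSpace (𝓡 m) p

/-! ### Orientations -/

/-- The vectors `v 0, …, v (m-1)` form a basis which is positive for the orientation `o`. -/
def IsPositiveBasis {m : ℕ} {W : Type*} [AddCommGroup W] [Module ℝ W]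
    (o : Orientation ℝ W (Fin m)) (v : Fin m → W) : Prop :=
  ∃ b : Module.Basis (Fin m) ℝ W, (∀ i, b i = v i) ∧ b.orientation = o

/-- An orientation of an `m`-manifold: an orientation of every tangent space which, read in the
chart at any point `x₀`, is locally constant near `x₀`. -/
structure ManifoldOrientation (m : ℕ) (M : Type*) [TopologicalSpace M]
    [ChartedSpace (Model m) M] where
  /-- the orientation of the tangent space at `p` -/
  at_point : (p : M) → Orientation ℝ (Tan (m := m) p) (Fin m)
  /-- near `x₀`, the differential of the chart at `x₀` carries the orientations of the tangent
  spaces to one and the same orientation of `ℝ^m` -/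
  locally_constant : ∀ x₀ : M, ∃ o₀ : Orientation ℝ (Model m) (Fin m), ∀ᶠ p in 𝓝 x₀,
    ∀ v : Fin m → Tan (m := m) p,
      IsPositiveBasis (at_point p) v ↔
        IsPositiveBasis (W := Model m) o₀
          (fun i => mfderiv (𝓡 m) 𝓘(ℝ, Model m) (extChartAt (𝓡 m) x₀) p (v i))

section Riemannian

variable {m : ℕ} {M : Type*} [TopologicalSpace M] [ChartedSpace (Model m) M]

/-! ### The Levi-Civita connection in coordinates -/

/-- The coordinate vector field `∂_i` of the chart at `x₀`, at the point with coordinates `y`. -/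
def coordField (x₀ : M) (y : Model m) (i : Fin m) :
    Tan (m := m) ((extChartAt (𝓡 m) x₀).symm y) :=
  mfderiv 𝓘(ℝ, Model m) (𝓡 m) (extChartAt (𝓡 m) x₀).symm y (EuclideanSpace.single i (1 : ℝ))

variable [RiemannianBundle (fun p : M => TangentSpace (𝓡 m) p)]

/-- The coefficients `g_ij = ⟨∂_i, ∂_j⟩` of the metric in the chart at `x₀`, as functions of the
coordinates. -/
def metricCoeff (x₀ : M) (y : Model m) : Matrix (Fin m) (Fin m) ℝ :=
  Matrix.of fun i j => inner ℝ (coordField x₀ y i) (coordField x₀ y j)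

/-- The partial derivative `∂_l g_ij` in the chart at `x₀`. -/
def metricPartial (x₀ : M) (y : Model m) (l i j : Fin m) : ℝ :=
  fderiv ℝ (fun z => metricCoeff x₀ z i j) y (EuclideanSpace.single l (1 : ℝ))

/-- The Christoffel symbol
`Γ^k_ij = 1/2 ∑_l g^{kl} (∂_i g_jl + ∂_j g_il - ∂_l g_ij)` of the Levi-Civita connection in the
chart at `x₀`. -/
def christoffel (x₀ : M) (y : Model m) (k i j : Fin m) : ℝ :=
  (1 / 2) * ∑ l, (metricCoeff x₀ y)⁻¹ k l *
    (metricPartial x₀ y i j l + metricPartial x₀ y j i l - metricPartial x₀ y l i j)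

/-! ### Curves and vector fields along curves -/

variable [IsManifold (𝓡 m) ∞ M]

/-- The velocity `γ'(s)`, for a curve `γ` defined on the interval `I`. -/
def velocity (γ : ℝ → M) (I : Set ℝ) (s : ℝ) : Tan (m := m) (γ s) :=
  mfderivWithin 𝓘(ℝ, ℝ) (𝓡 m) γ I s (1 : ℝ)

/-- `V` is a smooth vector field along `γ : I → M`. -/
def IsSmoothAlong (γ : ℝ → M) (I : Set ℝ) (V : (s : ℝ) → Tan (m := m) (γ s)) : Prop :=
  ContMDiffOn 𝓘(ℝ, ℝ) (𝓡 m).tangent ∞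
    (fun s => (⟨γ s, V s⟩ : TangentBundle (𝓡 m) M)) I

/-- The components, in the chart at `x₀`, of a vector field along `γ`. -/
def coordAlong (x₀ : M) (γ : ℝ → M) (V : (s : ℝ) → Tan (m := m) (γ s)) (s : ℝ) : Model m :=
  mfderiv (𝓡 m) 𝓘(ℝ, Model m) (extChartAt (𝓡 m) x₀) (γ s) (V s)

/-- The components of `∇_{γ'} V` at `s` in the chart at `x₀`:
`dV^k/ds + ∑_ij Γ^k_ij (dγ^i/ds) V^j`. -/
def covDerivCoord (x₀ : M) (γ : ℝ → M) (I : Set ℝ) (V : (s : ℝ) → Tan (m := m) (γ s)) (s : ℝ)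
    (k : Fin m) : ℝ :=
  derivWithin (coordAlong x₀ γ V) I s k +
    ∑ i, ∑ j, christoffel x₀ (extChartAt (𝓡 m) x₀ (γ s)) k i j *
      derivWithin (fun t => extChartAt (𝓡 m) x₀ (γ t)) I s i * coordAlong x₀ γ V s j

/-- The covariant derivative `∇_{γ'} V` along `γ : I → M` for the Levi-Civita connection, computed
at the parameter `s` in the chart at `γ s`. -/
def covDerivAlong (γ : ℝ → M) (I : Set ℝ) (V : (s : ℝ) → Tan (m := m) (γ s)) (s : ℝ) :
    Tan (m := m) (γ s) :=
  mfderiv 𝓘(ℝ, Model m) (𝓡 m) (extChartAt (𝓡 m) (γ s)).symm (extChartAt (𝓡 m) (γ s) (γ s))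
    (WithLp.toLp 2 (covDerivCoord (γ s) γ I V s))

/-- The iterated covariant derivatives `γ', ∇_{γ'} γ', ∇²_{γ'} γ', …` -/
def iterVelocity (γ : ℝ → M) (I : Set ℝ) : ℕ → (s : ℝ) → Tan (m := m) (γ s)
  | 0 => fun s => velocity γ I s
  | k + 1 => fun s => covDerivAlong (m := m) γ I (iterVelocity γ I k) s

/-- A Frenet curve in an `m`-manifold: a smooth curve for which
`γ', ∇_{γ'} γ', …, ∇^{m-1}_{γ'} γ'` are linearly independent at every parameter. -/
structure IsFrenetCurve (γ : ℝ → M) (I : Set ℝ) : Prop where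
  smooth : ContMDiffOn 𝓘(ℝ, ℝ) (𝓡 m) ∞ γ I
  independent : ∀ s ∈ I, LinearIndependent ℝ (fun i : Fin m => iterVelocity (m := m) γ I i s)

/-- The curve is parametrized by arc length. -/
def IsArcLength (γ : ℝ → M) (I : Set ℝ) : Prop :=
  ∀ s ∈ I, ‖velocity (m := m) γ I s‖ = 1

/-- `V` is torse-forming along `γ`, with potential function `f` and generating form `om`:
`∇_T V = f T + om(T) V`, where `T = γ'`. -/
structure IsTorseForming (γ : ℝ → M) (I : Set ℝ) (V : (s : ℝ) → Tan (m := m) (γ s))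
    (f : ℝ → ℝ) (om : (s : ℝ) → Tan (m := m) (γ s) →L[ℝ] ℝ) : Prop where
  smooth : IsSmoothAlong γ I V
  smooth_potential : ContDiffOn ℝ ∞ f I
  smooth_form : ContDiffOn ℝ ∞ (fun s => om s (velocity γ I s)) I
  eq : ∀ s ∈ I, covDerivAlong γ I V s = f s • velocity γ I s + om s (velocity γ I s) • V s

/-- `γ : I → M` is a prescribed angle (PA) curve with `(V, θ)`, where `N` is its principal normal:
`γ` is a Frenet curve parametrized by arc length, `V` is a nowhere zero vector field along `γ` of
unit length, and the smooth function `θ : I → [0, π]` is the angle between `V` and `N`. -/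
structure IsPACurve (γ : ℝ → M) (I : Set ℝ) (N V : (s : ℝ) → Tan (m := m) (γ s))
    (θ : ℝ → ℝ) : Prop where
  frenet : IsFrenetCurve (m := m) γ I
  arcLength : IsArcLength (m := m) γ I
  smooth : IsSmoothAlong γ I V
  ne_zero : ∀ s ∈ I, V s ≠ 0
  smooth_angle : ContDiffOn ℝ ∞ θ I
  angle_mem : ∀ s ∈ I, θ s ∈ Icc 0 Real.pi
  unit : ∀ s ∈ I, ‖V s‖ = 1
  angle_eq : ∀ s ∈ I, InnerProductGeometry.angle (V s) (N s) = θ s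

end Riemannian

/-! ### Frenet frames

From here on the dimension is `m = n + 2`, so that a principal normal exists. The frame
`X_1, …, X_m` is written `X 0, …, X (n+1)`; thus `T = X 0`, `N = X 1` and `B_i = X (i+1)` for
`1 ≤ i ≤ n = m - 2`. The curvatures are `κ 1, …, κ (n+1)`, with their usual indices; the values
of `κ` at other indices play no role. -/

section Frenet

variable {n : ℕ} {M : Type*} [TopologicalSpace M] [ChartedSpace (Model (n + 2)) M]
  [IsManifold (𝓡 (n + 2)) ∞ M] [RiemannianBundle (fun p : M => TangentSpace (𝓡 (n + 2)) p)]

/-- `X` is the Frenet frame and `κ` are the curvatures of the unit speed curve `γ : I → M`.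
The curvatures `κ_1, …, κ_{m-2}` are positive; as the frame is positively oriented, the sign of
the last curvature `κ_{m-1}` is not prescribed. -/
structure IsFrenetFrame (o : ManifoldOrientation (n + 2) M) (γ : ℝ → M) (I : Set ℝ)
    (X : Fin (n + 2) → (s : ℝ) → Tan (m := n + 2) (γ s)) (κ : ℕ → ℝ → ℝ) : Prop where
  smooth_frame : ∀ i, IsSmoothAlong γ I (X i)
  smooth_curvature : ∀ i, 1 ≤ i → i ≤ n + 1 → ContDiffOn ℝ ∞ (κ i) I
  curvature_pos : ∀ i, 1 ≤ i → i ≤ n → ∀ s ∈ I, 0 < κ i s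
  orthonormal : ∀ s ∈ I, Orthonormal ℝ (fun i => X i s)
  positive : ∀ s ∈ I, IsPositiveBasis (o.at_point (γ s)) (fun i => X i s)
  tangent : ∀ s ∈ I, X 0 s = velocity γ I s
  span_eq : ∀ s ∈ I, Submodule.span ℝ (range fun i => X i s) =
    Submodule.span ℝ (range fun i : Fin (n + 2) => iterVelocity γ I i s)
  frenet_first : ∀ s ∈ I, covDerivAlong γ I (X 0) s = κ 1 s • X 1 s
  /-- the formula `∇_T X_j = -κ_{j-1} X_{j-1} + κ_j X_{j+1}` for `j = i + 2`, `2 ≤ j ≤ m - 1` -/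
  frenet_middle : ∀ i : Fin n, ∀ s ∈ I, covDerivAlong γ I (X i.castSucc.succ) s =
    -(κ (i + 1) s) • X i.castSucc.castSucc s + κ (i + 2) s • X i.succ.succ s
  frenet_last : ∀ s ∈ I, covDerivAlong γ I (X (Fin.last (n + 1))) s =
    -(κ (n + 1) s) • X (Fin.last n).castSucc s

/-- The vector field `λ_0 T + cos θ N + λ_1 B_1 + ⋯ + λ_{m-2} B_{m-2}`. -/
def frameCombination {γ : ℝ → M} (X : Fin (n + 2) → (s : ℝ) → Tan (m := n + 2) (γ s))
    (θ : ℝ → ℝ) (lam : ℕ → ℝ → ℝ) (s : ℝ) : Tan (m := n + 2) (γ s) :=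
  lam 0 s • X 0 s + Real.cos (θ s) • X 1 s + ∑ i : Fin n, lam (i + 1) s • X i.succ.succ s

end Frenet

/-- The normalization `1 = cos² θ + ∑_{i=0}^{m-2} λ_i²` on `I`, where `m = n + 2`. -/
def UnitCoeff (n : ℕ) (I : Set ℝ) (θ : ℝ → ℝ) (lam : ℕ → ℝ → ℝ) : Prop :=
  ∀ s ∈ I, 1 = Real.cos (θ s) ^ 2 + ∑ i ∈ Finset.range (n + 1), lam i s ^ 2

/-- The system of ordinary differential equations on `I` which relates the curvatures, the angle,
the potential function and the components `λ_0, …, λ_{m-2}`, where `m = n + 2`. In dimensions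
2 and 3 the terms and equations that involve `λ_i` with `i > m - 2` are absent. -/
structure CurvatureSystem (n : ℕ) (I : Set ℝ) (f θ : ℝ → ℝ) (lam κ : ℕ → ℝ → ℝ) : Prop where
  eq_T : ∀ s ∈ I,
    f s * (1 - lam 0 s ^ 2) - derivWithin (lam 0) I s + κ 1 s * Real.cos (θ s) = 0
  eq_N : ∀ s ∈ I,
    -f s * lam 0 s * Real.cos (θ s) + derivWithin θ I s * Real.sin (θ s) - lam 0 s * κ 1 s
      + (if 1 ≤ n then lam 1 s * κ 2 s else 0) = 0
  eq_B_first : 1 ≤ n → ∀ s ∈ I,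
    -f s * lam 0 s * lam 1 s - derivWithin (lam 1) I s
      + (if 2 ≤ n then lam 2 s * κ 3 s else 0) - κ 2 s * Real.cos (θ s) = 0
  eq_B_middle : ∀ i, 2 ≤ i → i + 1 ≤ n → ∀ s ∈ I,
    -f s * lam 0 s * lam i s - derivWithin (lam i) I s
      - lam (i - 1) s * κ (i + 1) s + lam (i + 1) s * κ (i + 2) s = 0
  eq_B_last : 2 ≤ n → ∀ s ∈ I,
    -f s * lam 0 s * lam n s - derivWithin (lam n) I s - lam (n - 1) s * κ (n + 1) s = 0

end

/-!
A unit field `V` along a Frenet curve has components `a = (λ_0, cos θ, λ_1, …, λ_{m-2})` in the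
Frenet frame, where the second one is `cos θ` exactly because `θ` is the angle between `V` and `N`.
By the Leibniz rule and the Frenet equations `∇_T X_i = ∑_j K_ij X_j`, with `K` skew, the `j`-th
component of `∇_T V` is `a_j' + ∑_i a_i K_ij`. Differentiating `⟨V, V⟩ = 1` shows that
`∇_T V = f T + ω(T) V` forces `ω(T) = -f λ_0`. So the equation says
`a_j' + ∑_i a_i K_ij = f δ_{j0} - f λ_0 a_j` for all `j`, which is the system
(`curvatureSystem_iff`). This gives the characterization
(`exists_frameCoeff_of_isTorseForming`, `isTorseForming_of_curvatureSystem`), and it reduces the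
construction to finding a Frenet curve with given curvatures and initial frame
(`exists_frenetCurve`).

For this the Frenet equations are solved in the chart at the initial point `p₀`
(`exists_frenet_solution`), and the solution is carried back to the manifold. The covariant
derivative is defined by the chart at the moving point, so its independence of the chart is needed
(`toCoord_covDerivAlong`). It follows from the transformation law of the Christoffel symbols, which
is derived from the Koszul formula (`chartMetric_christoffelVec`,
`fderiv_chartTransition_christoffelVec`). The frame stays orthonormal because `K` is skew and the
connection is metric (`gram_eq_one_of_skew`, `hasDerivWithinAt_inner`), and positively oriented on a
short interval by continuity of the determinant. Finally the iterated derivatives of `γ'` are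
expressed in the frame by a triangular matrix with diagonal entries `κ_1 ⋯ κ_k ≠ 0`, so the curve is
a Frenet curve (`isFrenetCurve_of_frame`).
-/

noncomputable section

/-! ### Components of tangent vectors in a chart -/

section Charts

variable {m : ℕ} {M : Type*} [TopologicalSpace M] [ChartedSpace (Model m) M]
  [IsManifold (𝓡 m) ∞ M]

/-- The components of a tangent vector at `p` in the chart at `x₀`. It is taken from the
trivialization of the tangent bundle, which keeps its type over `p`; on the chart domain it is the
differential of the chart. -/
def toCoord (x₀ p : M) : Tan (m := m) p →L[ℝ] Model m :=
  (trivializationAt (Model m) (TangentSpace (𝓡 m) : M → Type _) x₀).continuousLinearMapAt ℝ p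

/-- The tangent vector at `p` with given components in the chart at `x₀`; it is inverse to `toCoord`
when `p` lies in the chart domain. -/
def ofCoord (x₀ p : M) : Model m →L[ℝ] Tan (m := m) p :=
  (trivializationAt (Model m) (TangentSpace (𝓡 m) : M → Type _) x₀).symmL ℝ p

theorem ofCoord_toCoord {x₀ p : M} (hp : p ∈ (extChartAt (𝓡 m) x₀).source)
    (v : Tan (m := m) p) : ofCoord x₀ p (toCoord x₀ p v) = v := by
  apply Trivialization.symmL_continuousLinearMapAt
  simpa using hp

theorem toCoord_ofCoord {x₀ p : M} (hp : p ∈ (extChartAt (𝓡 m) x₀).source)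
    (v : Model m) : toCoord x₀ p (ofCoord x₀ p v) = v := by
  apply Trivialization.continuousLinearMapAt_symmL
  simpa using hp

theorem mfderiv_extChartAt_apply {x₀ p : M} (hp : p ∈ (extChartAt (𝓡 m) x₀).source)
    (v : Tan (m := m) p) :
    mfderiv (𝓡 m) 𝓘(ℝ, Model m) (extChartAt (𝓡 m) x₀) p v = toCoord x₀ p v := by
  rw [toCoord, TangentBundle.continuousLinearMapAt_trivializationAt]
  · rfl
  · simpa using hp

theorem mfderiv_extChartAt_symm_apply {x₀ p : M} (hp : p ∈ (extChartAt (𝓡 m) x₀).source)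
    (v : Model m) :
    mfderiv 𝓘(ℝ, Model m) (𝓡 m) (extChartAt (𝓡 m) x₀).symm (extChartAt (𝓡 m) x₀ p) v
      = ofCoord x₀ p v := by
  rw [ofCoord, TangentBundle.symmL_trivializationAt (by simpa using hp),
    ← mfderivWithin_univ]
  congr 1
  simp
  rfl

theorem toCoord_eq_snd {x₀ p : M} (hp : p ∈ (extChartAt (𝓡 m) x₀).source)
    (v : Tan (m := m) p) :
    toCoord x₀ p v =
      (trivializationAt (Model m) (TangentSpace (𝓡 m) : M → Type _) x₀ ⟨p, v⟩).2 := by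
  rw [toCoord, Trivialization.continuousLinearMapAt_apply, Trivialization.coe_linearMapAt_of_mem]
  simpa using hp

/-- The change of components between two charts is the derivative of the transition map. -/
theorem toCoord_ofCoord_eq_fderiv {x₀ x₁ p : M} (hp : p ∈ (extChartAt (𝓡 m) x₀).source)
    (hp₁ : p ∈ (extChartAt (𝓡 m) x₁).source) (v : Model m) :
    toCoord x₁ p (ofCoord x₀ p v) =
      fderiv ℝ (extChartAt (𝓡 m) x₁ ∘ (extChartAt (𝓡 m) x₀).symm) (extChartAt (𝓡 m) x₀ p) v := by
  have hy : extChartAt (𝓡 m) x₀ p ∈ (extChartAt (𝓡 m) x₀).target :=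
    (extChartAt (𝓡 m) x₀).map_source hp
  have hsymm : MDifferentiableAt 𝓘(ℝ, Model m) (𝓡 m) (extChartAt (𝓡 m) x₀).symm
      (extChartAt (𝓡 m) x₀ p) := by
    have := mdifferentiableWithinAt_extChartAt_symm (I := 𝓡 m) hy
    rwa [modelWithCornersSelf_coe, range_id, mdifferentiableWithinAt_univ] at this
  have hq : (extChartAt (𝓡 m) x₀).symm (extChartAt (𝓡 m) x₀ p) ∈
      (extChartAt (𝓡 m) x₁).source := by rwa [(extChartAt (𝓡 m) x₀).left_inv hp]
  have hext : MDifferentiableAt (𝓡 m) 𝓘(ℝ, Model m) (extChartAt (𝓡 m) x₁)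
      ((extChartAt (𝓡 m) x₀).symm (extChartAt (𝓡 m) x₀ p)) :=
    mdifferentiableAt_extChartAt (by simpa using hq)
  rw [← mfderiv_eq_fderiv, mfderiv_comp _ hext hsymm]
  rw [← mfderiv_extChartAt_apply hp₁, ← mfderiv_extChartAt_symm_apply hp]
  -- `p` and its image under the chart and its inverse are equal, but not definitionally; the
  -- statement is generalized to `q = p` to transport between the two tangent spaces
  have key : ∀ q : M, q = p → ∀ w : Model m,
      (mfderiv (𝓡 m) 𝓘(ℝ, Model m) (extChartAt (𝓡 m) x₁) p : Model m →L[ℝ] Model m) w =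
      (mfderiv (𝓡 m) 𝓘(ℝ, Model m) (extChartAt (𝓡 m) x₁) q : Model m →L[ℝ] Model m) w := by
    rintro q rfl w; rfl
  exact key _ ((extChartAt (𝓡 m) x₀).left_inv hp) _

theorem toCoord_velocity {x₀ : M} {γ : ℝ → M} {I : Set ℝ} {s : ℝ}
    (hγ : MDifferentiableWithinAt 𝓘(ℝ, ℝ) (𝓡 m) γ I s) (hI : UniqueDiffWithinAt ℝ I s)
    (hs : γ s ∈ (extChartAt (𝓡 m) x₀).source) :
    toCoord x₀ (γ s) (velocity γ I s) =
      derivWithin (fun t => extChartAt (𝓡 m) x₀ (γ t)) I s := by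
  rw [← mfderiv_extChartAt_apply hs, ← fderivWithin_derivWithin, ← mfderivWithin_eq_fderivWithin,
    velocity]
  have := mfderiv_comp_mfderivWithin (I := 𝓘(ℝ, ℝ)) (I' := 𝓡 m) (I'' := 𝓘(ℝ, Model m)) s
    (g := extChartAt (𝓡 m) x₀) (f := γ) (s := I)
    (mdifferentiableAt_extChartAt (by simpa using hs)) hγ hI.uniqueMDiffWithinAt
  exact (congrArg (fun L : ℝ →L[ℝ] Model m => L 1) this).symm

/-- A map into the tangent bundle is smooth when its base map and its components in one chart are;
this makes smoothness of a vector field along a curve a statement about `ℝ^m`-valued functions. -/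
theorem contMDiffWithinAt_tangent_iff {E : Type*} [NormedAddCommGroup E] [NormedSpace ℝ E]
    {x₀ : M} {γ : E → M} {V : (s : E) → Tan (m := m) (γ s)} {I : Set E} {s : E}
    (hs : γ s ∈ (extChartAt (𝓡 m) x₀).source) :
    ContMDiffWithinAt 𝓘(ℝ, E) (𝓡 m).tangent ∞
      (fun s => (⟨γ s, V s⟩ : TangentBundle (𝓡 m) M)) I s ↔
    ContMDiffWithinAt 𝓘(ℝ, E) (𝓡 m) ∞ γ I s ∧
      ContDiffWithinAt ℝ ∞ (fun t => toCoord x₀ (γ t) (V t)) I s := by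
  have h := (trivializationAt (Model m) (TangentSpace (𝓡 m) : M → Type _) x₀).contMDiffWithinAt_iff
    (IM := 𝓘(ℝ, E)) (IB := 𝓡 m) (n := ∞)
    (f := fun s => (⟨γ s, V s⟩ : TangentBundle (𝓡 m) M)) (s := I) (x₀ := s)
    (by rw [Trivialization.mem_source]; simpa using hs)
  rw [h]
  refine and_congr_right fun hγ => ?_
  rw [contMDiffWithinAt_iff_contDiffWithinAt]
  have hev : (fun t => toCoord x₀ (γ t) (V t)) =ᶠ[𝓝[I] s] fun t =>
      (trivializationAt (Model m) (TangentSpace (𝓡 m) : M → Type _) x₀ ⟨γ t, V t⟩).2 := by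
    filter_upwards [hγ.continuousWithinAt.preimage_mem_nhdsWithin
      ((isOpen_extChartAt_source (I := 𝓡 m) x₀).mem_nhds hs)] with t ht
    exact toCoord_eq_snd ht _
  exact ⟨fun h => h.congr_of_eventuallyEq hev (toCoord_eq_snd hs _),
    fun h => h.congr_of_eventuallyEq hev.symm (toCoord_eq_snd hs _).symm⟩

theorem contMDiffOn_ofCoord (x₀ : M) (v : Model m) :
    ContMDiffOn 𝓘(ℝ, Model m) (𝓡 m).tangent ∞
      (fun y => (⟨(extChartAt (𝓡 m) x₀).symm y, ofCoord x₀ ((extChartAt (𝓡 m) x₀).symm y) v⟩ :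
        TangentBundle (𝓡 m) M)) (extChartAt (𝓡 m) x₀).target := by
  intro y hy
  have hs := (extChartAt (𝓡 m) x₀).map_target hy
  rw [contMDiffWithinAt_tangent_iff hs]
  refine ⟨contMDiffOn_extChartAt_symm x₀ y hy, ?_⟩
  refine (contDiffWithinAt_const (c := v)).congr (fun z hz => ?_) ?_
  · exact toCoord_ofCoord ((extChartAt (𝓡 m) x₀).map_target hz) v
  · exact toCoord_ofCoord hs v

theorem coordField_eq {x₀ : M} {y : Model m} (hy : y ∈ (extChartAt (𝓡 m) x₀).target)
    (i : Fin m) : coordField x₀ y i =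
      ofCoord x₀ ((extChartAt (𝓡 m) x₀).symm y) (EuclideanSpace.single i (1 : ℝ)) := by
  rw [← mfderiv_extChartAt_symm_apply ((extChartAt (𝓡 m) x₀).map_target hy), coordField]
  have key : ∀ z : Model m, z = y → ∀ w : Model m,
      (mfderiv 𝓘(ℝ, Model m) (𝓡 m) (extChartAt (𝓡 m) x₀).symm y : Model m →L[ℝ] Model m) w =
      (mfderiv 𝓘(ℝ, Model m) (𝓡 m) (extChartAt (𝓡 m) x₀).symm z : Model m →L[ℝ] Model m) w := by
    rintro z rfl w; rfl
  exact key _ ((extChartAt (𝓡 m) x₀).right_inv hy) _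

end Charts

/-! ### The metric and the Christoffel symbols in a chart -/

section Metric

variable {m : ℕ} {M : Type*} [TopologicalSpace M] [ChartedSpace (Model m) M]
  [RiemannianBundle (fun p : M => TangentSpace (𝓡 m) p)]
  [IsManifold (𝓡 m) ∞ M]

/-- The metric in the chart at `x₀`, as a bilinear form on `ℝ^m` depending on the coordinates
`y`. -/
def chartMetric (x₀ : M) (y v w : Model m) : ℝ :=
  inner ℝ (ofCoord x₀ ((extChartAt (𝓡 m) x₀).symm y) v)
    (ofCoord x₀ ((extChartAt (𝓡 m) x₀).symm y) w)

theorem inner_eq_chartMetric {x₀ p : M} (hp : p ∈ (extChartAt (𝓡 m) x₀).source)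
    (v w : Tan (m := m) p) : inner ℝ v w =
      chartMetric x₀ (extChartAt (𝓡 m) x₀ p) (toCoord x₀ p v) (toCoord x₀ p w) := by
  have key : ∀ q : M, q = p → inner ℝ v w =
      inner ℝ (ofCoord x₀ q (toCoord x₀ p v)) (ofCoord x₀ q (toCoord x₀ p w)) := by
    rintro q rfl
    rw [ofCoord_toCoord hp, ofCoord_toCoord hp]
  exact key _ ((extChartAt (𝓡 m) x₀).left_inv hp)

theorem chartMetric_comm (x₀ : M) (y v w : Model m) :
    chartMetric x₀ y v w = chartMetric x₀ y w v := real_inner_comm _ _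

theorem chartMetric_add_left (x₀ : M) (y u v w : Model m) :
    chartMetric x₀ y (u + v) w = chartMetric x₀ y u w + chartMetric x₀ y v w := by
  rw [chartMetric, map_add, inner_add_left]; rfl

theorem chartMetric_add_right (x₀ : M) (y u v w : Model m) :
    chartMetric x₀ y u (v + w) = chartMetric x₀ y u v + chartMetric x₀ y u w := by
  rw [chartMetric, ContinuousLinearMap.map_add, inner_add_right]; rfl

theorem chartMetric_sub_left (x₀ : M) (y u v w : Model m) :
    chartMetric x₀ y (u - v) w = chartMetric x₀ y u w - chartMetric x₀ y v w := by
  rw [chartMetric, ContinuousLinearMap.map_sub]; erw [inner_sub_left]; rfl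

theorem eq_of_chartMetric_eq {x₀ : M} {y : Model m} (hy : y ∈ (extChartAt (𝓡 m) x₀).target)
    {u v : Model m} (h : ∀ w, chartMetric x₀ y u w = chartMetric x₀ y v w) : u = v := by
  have h0 : chartMetric x₀ y (u - v) (u - v) = 0 := by
    rw [chartMetric_sub_left, h, sub_self]
  have h1 := inner_self_eq_zero.1 h0
  have := congrArg (toCoord x₀ ((extChartAt (𝓡 m) x₀).symm y)) h1
  rw [toCoord_ofCoord ((extChartAt (𝓡 m) x₀).map_target hy), map_zero] at this
  exact sub_eq_zero.1 this

theorem chartMetric_expand (x₀ : M) (y v w : Model m) :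
    chartMetric x₀ y v w = ∑ i, ∑ j, v i * w j *
      chartMetric x₀ y (EuclideanSpace.single i 1) (EuclideanSpace.single j 1) := by
  have h : ∀ v : Model m, v = ∑ i, v i • EuclideanSpace.single i (1 : ℝ) := by
    intro v
    ext j
    simp [Pi.single_apply]
  conv_lhs => rw [h v, h w]
  simp only [chartMetric, map_sum, map_smul, sum_inner, inner_sum, inner_smul_left,
    inner_smul_right]
  simp only [Finset.mul_sum]
  rw [Finset.sum_comm]
  refine Finset.sum_congr rfl fun i _ => Finset.sum_congr rfl fun j _ => ?_
  simp only [conj_trivial]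
  ring

theorem metricCoeff_eq {x₀ : M} {y : Model m} (hy : y ∈ (extChartAt (𝓡 m) x₀).target)
    (i j : Fin m) : metricCoeff x₀ y i j =
      chartMetric x₀ y (EuclideanSpace.single i 1) (EuclideanSpace.single j 1) := by
  simp [metricCoeff, chartMetric, coordField_eq hy]

theorem contDiffOn_chartMetric
    [IsContMDiffRiemannianBundle (𝓡 m) ∞ (Model m) (fun p : M => TangentSpace (𝓡 m) p)]
    (x₀ : M) (v w : Model m) :
    ContDiffOn ℝ ∞ (fun y => chartMetric x₀ y v w) (extChartAt (𝓡 m) x₀).target := by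
  rw [← contMDiffOn_iff_contDiffOn]
  exact (contMDiffOn_ofCoord x₀ v).inner_bundle (contMDiffOn_ofCoord x₀ w)

/-- The derivative in the direction `u` of the function `y ↦ g_y(v, w)`, where `g` is the metric in
the chart and `v`, `w` are constant. -/
def chartMetricDeriv (x₀ : M) (y u v w : Model m) : ℝ :=
  fderiv ℝ (fun z => chartMetric x₀ z v w) y u

/-- The Christoffel symbols as a bilinear map: `Γ_y(u, v)^k = ∑_ij Γ^k_ij u^i v^j`. -/
def christoffelVec (x₀ : M) (y u v : Model m) : Model m :=
  WithLp.toLp 2 fun k => ∑ i, ∑ j, christoffel x₀ y k i j * u i * v j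

theorem metricPartial_eq {x₀ : M} {y : Model m} (hy : y ∈ (extChartAt (𝓡 m) x₀).target)
    (l i j : Fin m) : metricPartial x₀ y l i j =
      chartMetricDeriv x₀ y (EuclideanSpace.single l 1) (EuclideanSpace.single i 1)
        (EuclideanSpace.single j 1) := by
  rw [metricPartial, chartMetricDeriv]
  congr 1
  apply Filter.EventuallyEq.fderiv_eq
  filter_upwards [(isOpen_extChartAt_target x₀).mem_nhds hy] with z hz
  exact metricCoeff_eq hz i j

theorem isUnit_det_metricCoeff (x₀ : M) {y : Model m} (hy : y ∈ (extChartAt (𝓡 m) x₀).target) :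
    IsUnit (metricCoeff x₀ y).det := by
  rw [isUnit_iff_ne_zero]
  intro h0
  obtain ⟨v, hv, hv0⟩ := Matrix.exists_mulVec_eq_zero_iff.2 h0
  apply hv
  have : (WithLp.toLp 2 v : Model m) = 0 := by
    apply eq_of_chartMetric_eq hy
    intro w
    have h1 : ∀ u : Model m, chartMetric x₀ y u w =
        ∑ j, w j * ((metricCoeff x₀ y).mulVec u) j := by
      intro u
      rw [chartMetric_expand, Finset.sum_comm]
      refine Finset.sum_congr rfl fun j _ => ?_
      rw [Matrix.mulVec, dotProduct, Finset.mul_sum]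
      refine Finset.sum_congr rfl fun i _ => ?_
      rw [metricCoeff_eq hy, chartMetric_comm]
      ring
    rw [h1, h1]
    simp [hv0]
  simpa using congrArg (fun u : Model m => u.ofLp) this

theorem sum_metricCoeff_mul_christoffel (x₀ : M) {y : Model m}
    (hy : y ∈ (extChartAt (𝓡 m) x₀).target) (l i j : Fin m) :
    ∑ k, metricCoeff x₀ y l k * christoffel x₀ y k i j = (1 / 2) *
      (metricPartial x₀ y i j l + metricPartial x₀ y j i l - metricPartial x₀ y l i j) := by
  -- multiply the definition of the symbols by `g` and use `g g⁻¹ = 1`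
  have h := congrFun (congrArg (fun A : Matrix (Fin m) (Fin m) ℝ => A.mulVec
    (fun l => metricPartial x₀ y i j l + metricPartial x₀ y j i l - metricPartial x₀ y l i j))
    (Matrix.mul_nonsing_inv _ (isUnit_det_metricCoeff x₀ hy))) l
  simp only [← Matrix.mulVec_mulVec, Matrix.one_mulVec] at h
  rw [← h]
  simp only [christoffel, Matrix.mulVec, dotProduct, Finset.mul_sum]
  refine Finset.sum_congr rfl fun k _ => Finset.sum_congr rfl fun l' _ => ?_
  ring

section Smooth

variable [IsContMDiffRiemannianBundle (𝓡 m) ∞ (Model m) (fun p : M => TangentSpace (𝓡 m) p)]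

theorem differentiableAt_chartMetric {x₀ : M} {y : Model m}
    (hy : y ∈ (extChartAt (𝓡 m) x₀).target) (v w : Model m) :
    DifferentiableAt ℝ (fun z => chartMetric x₀ z v w) y :=
  ((contDiffOn_chartMetric x₀ v w).contDiffAt ((isOpen_extChartAt_target x₀).mem_nhds hy)
    ).differentiableAt (by simp)

theorem chartMetricDeriv_expand_right {x₀ : M} {y : Model m}
    (hy : y ∈ (extChartAt (𝓡 m) x₀).target) (u v w : Model m) :
    chartMetricDeriv x₀ y u v w = ∑ i, ∑ j, v i * w j * chartMetricDeriv x₀ y u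
      (EuclideanSpace.single i 1) (EuclideanSpace.single j 1) := by
  rw [chartMetricDeriv, funext fun z => chartMetric_expand x₀ z v w, fderiv_fun_sum]
  · rw [sum_apply]
    refine Finset.sum_congr rfl fun i _ => ?_
    rw [fderiv_fun_sum]
    · rw [sum_apply]
      refine Finset.sum_congr rfl fun j _ => ?_
      rw [fderiv_const_mul (differentiableAt_chartMetric hy _ _)]
      rfl
    · intro j _
      exact (differentiableAt_chartMetric hy _ _).const_mul _
  · intro i _
    refine DifferentiableAt.fun_sum fun j _ => ?_
    exact (differentiableAt_chartMetric hy _ _).const_mul _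

theorem chartMetricDeriv_expand {x₀ : M} {y : Model m}
    (hy : y ∈ (extChartAt (𝓡 m) x₀).target) (u v w : Model m) :
    chartMetricDeriv x₀ y u v w =
      ∑ l, ∑ i, ∑ j, u l * v i * w j * metricPartial x₀ y l i j := by
  have h : u = ∑ i, u i • EuclideanSpace.single i (1 : ℝ) := by
    ext j
    simp [Pi.single_apply]
  have h2 : chartMetricDeriv x₀ y u v w =
      ∑ l, u l * chartMetricDeriv x₀ y (EuclideanSpace.single l 1) v w := by
    conv_lhs => rw [h]
    simp [chartMetricDeriv, map_sum]
  rw [h2]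
  refine Finset.sum_congr rfl fun l _ => ?_
  rw [chartMetricDeriv_expand_right hy, Finset.mul_sum]
  refine Finset.sum_congr rfl fun i _ => ?_
  rw [Finset.mul_sum]
  refine Finset.sum_congr rfl fun j _ => ?_
  rw [metricPartial_eq hy]
  ring

/-- The Koszul formula `2 g(Γ(u, v), w) = D_u g(v, w) + D_v g(u, w) - D_w g(u, v)`. As `g` is
nondegenerate, it characterizes `Γ`. -/
theorem chartMetric_christoffelVec {x₀ : M} {y : Model m}
    (hy : y ∈ (extChartAt (𝓡 m) x₀).target) (u v w : Model m) :
    2 * chartMetric x₀ y (christoffelVec x₀ y u v) w =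
      chartMetricDeriv x₀ y u v w + chartMetricDeriv x₀ y v u w - chartMetricDeriv x₀ y w u v := by
  have h1 : chartMetric x₀ y (christoffelVec x₀ y u v) w = ∑ l, ∑ i, ∑ j, u i * v j * w l *
      ∑ k, metricCoeff x₀ y l k * christoffel x₀ y k i j := by
    rw [chartMetric_expand, Finset.sum_comm]
    refine Finset.sum_congr rfl fun l _ => ?_
    simp only [christoffelVec, Finset.sum_mul, Finset.mul_sum]
    rw [Finset.sum_comm]
    refine Finset.sum_congr rfl fun i _ => ?_
    rw [Finset.sum_comm]
    refine Finset.sum_congr rfl fun j _ => Finset.sum_congr rfl fun k _ => ?_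
    rw [metricCoeff_eq hy, chartMetric_comm]
    ring
  rw [h1, chartMetricDeriv_expand hy, chartMetricDeriv_expand hy, chartMetricDeriv_expand hy w u v]
  simp only [sum_metricCoeff_mul_christoffel x₀ hy]
  rw [Finset.sum_comm_cycle (f := fun i j l => u i * v j * w l * metricPartial x₀ y i j l),
    Finset.sum_comm (f := fun l i => ∑ j, v l * u i * w j * metricPartial x₀ y l i j),
    Finset.sum_comm_cycle (f := fun i l j => v l * u i * w j * metricPartial x₀ y l i j)]
  simp only [Finset.mul_sum, ← Finset.sum_add_distrib, ← Finset.sum_sub_distrib]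
  refine Finset.sum_congr rfl fun l _ => Finset.sum_congr rfl fun i _ =>
    Finset.sum_congr rfl fun j _ => ?_
  ring

/-- Compatibility of the connection with the metric:
`D_u g(v, w) = g(Γ(u, v), w) + g(v, Γ(u, w))`. -/
theorem chartMetricDeriv_eq {x₀ : M} {y : Model m}
    (hy : y ∈ (extChartAt (𝓡 m) x₀).target) (u v w : Model m) :
    chartMetricDeriv x₀ y u v w = chartMetric x₀ y (christoffelVec x₀ y u v) w +
      chartMetric x₀ y v (christoffelVec x₀ y u w) := by
  have hc : ∀ a b c, chartMetricDeriv x₀ y a b c = chartMetricDeriv x₀ y a c b := by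
    intro a b c
    simp only [chartMetricDeriv, chartMetric_comm x₀ _ b c]
  have h1 := chartMetric_christoffelVec hy u v w
  have h2 := chartMetric_christoffelVec hy u w v
  rw [chartMetric_comm x₀ y v]
  rw [hc u w v] at h2
  linarith

end Smooth

end Metric

/-! ### Smoothness of the connection and change of charts -/

section CovDeriv

variable {m : ℕ} {M : Type*} [TopologicalSpace M] [ChartedSpace (Model m) M]
  [RiemannianBundle (fun p : M => TangentSpace (𝓡 m) p)]

theorem christoffelVec_add_right (x₀ : M) (y u v w : Model m) :
    christoffelVec x₀ y u (v + w) = christoffelVec x₀ y u v + christoffelVec x₀ y u w := by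
  ext k
  simp [christoffelVec, mul_add, Finset.sum_add_distrib]

theorem christoffelVec_smul_right (x₀ : M) (y u v : Model m) (a : ℝ) :
    christoffelVec x₀ y u (a • v) = a • christoffelVec x₀ y u v := by
  ext k
  simp only [christoffelVec, PiLp.smul_apply, smul_eq_mul, Finset.mul_sum]
  refine Finset.sum_congr rfl fun i _ => Finset.sum_congr rfl fun j _ => ?_
  ring

variable [IsManifold (𝓡 m) ∞ M]
  [IsContMDiffRiemannianBundle (𝓡 m) ∞ (Model m) (fun p : M => TangentSpace (𝓡 m) p)]

theorem contDiffOn_metricCoeff (x₀ : M) (i j : Fin m) :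
    ContDiffOn ℝ ∞ (fun y => metricCoeff x₀ y i j) (extChartAt (𝓡 m) x₀).target :=
  (contDiffOn_chartMetric x₀ _ _).congr fun _ hy => metricCoeff_eq hy i j

theorem contDiffOn_metricPartial (x₀ : M) (l i j : Fin m) :
    ContDiffOn ℝ ∞ (fun y => metricPartial x₀ y l i j) (extChartAt (𝓡 m) x₀).target :=
  ((contDiffOn_metricCoeff x₀ i j).fderiv_of_isOpen (m := ∞) (isOpen_extChartAt_target x₀)
    (by simp)).clm_apply contDiffOn_const

theorem contDiffOn_det {E : Type*} [NormedAddCommGroup E] [NormedSpace ℝ E] {U : Set E}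
    {k : ℕ} {A : E → Matrix (Fin k) (Fin k) ℝ} {r : WithTop ℕ∞}
    (hA : ∀ i j, ContDiffOn ℝ r (fun y => A y i j) U) :
    ContDiffOn ℝ r (fun y => (A y).det) U := by
  simp only [Matrix.det_apply]
  refine ContDiffOn.sum fun σ _ => ContDiffOn.const_smul _ ?_
  exact contDiffOn_prod fun i _ => hA _ _

/-- The inverse of the matrix of the metric is smooth by Cramer's rule. -/
theorem contDiffOn_christoffel (x₀ : M) (k i j : Fin m) :
    ContDiffOn ℝ ∞ (fun y => christoffel x₀ y k i j) (extChartAt (𝓡 m) x₀).target := by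
  have hp := contDiffOn_metricPartial (m := m) x₀
  refine contDiffOn_const.mul (ContDiffOn.sum fun l _ => ?_)
  refine ContDiffOn.mul ?_ (((hp i j l).add (hp j i l)).sub (hp l i j))
  have : ContDiffOn ℝ ∞ (fun y => (metricCoeff x₀ y).det⁻¹ * (metricCoeff x₀ y).adjugate k l)
      (extChartAt (𝓡 m) x₀).target := by
    refine ContDiffOn.mul ?_ ?_
    · exact (contDiffOn_det (contDiffOn_metricCoeff x₀)).inv
        fun y hy => (isUnit_det_metricCoeff x₀ hy).ne_zero
    · simp only [Matrix.adjugate_apply]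
      refine contDiffOn_det fun a b => ?_
      by_cases h : a = l
      · subst h
        simpa using contDiffOn_const
      · simpa [Matrix.updateRow_ne h] using contDiffOn_metricCoeff x₀ a b
  refine this.congr fun y _ => ?_
  simp [Matrix.inv_def]

/-- The product rule for `g_{c(t)}(v(t), w(t))`. -/
theorem hasDerivWithinAt_chartMetric {x₀ : M} {c v w : ℝ → Model m} {c' v' w' : Model m}
    {I : Set ℝ} {s : ℝ} (hs : c s ∈ (extChartAt (𝓡 m) x₀).target)
    (hc : HasDerivWithinAt c c' I s) (hv : HasDerivWithinAt v v' I s)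
    (hw : HasDerivWithinAt w w' I s) :
    HasDerivWithinAt (fun t => chartMetric x₀ (c t) (v t) (w t))
      (chartMetricDeriv x₀ (c s) c' (v s) (w s) + chartMetric x₀ (c s) v' (w s) +
        chartMetric x₀ (c s) (v s) w') I s := by
  have hcoord : ∀ {v : ℝ → Model m} {v' : Model m} (_ : HasDerivWithinAt v v' I s) (i : Fin m),
      HasDerivWithinAt (fun t => v t i) (v' i) I s := fun hv i =>
    (EuclideanSpace.proj (𝕜 := ℝ) i).hasFDerivAt.comp_hasDerivWithinAt s hv
  have key := HasDerivWithinAt.fun_sum (u := Finset.univ) fun i _ =>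
    HasDerivWithinAt.fun_sum (u := Finset.univ) fun j _ =>
    ((hcoord hv i).mul (hcoord hw j)).mul
      ((differentiableAt_chartMetric hs (EuclideanSpace.single i 1)
        (EuclideanSpace.single j 1)).hasFDerivAt.comp_hasDerivWithinAt s hc)
  refine (key.congr_deriv ?_).congr_of_eventuallyEq
    (Eventually.of_forall fun t => chartMetric_expand x₀ (c t) (v t) (w t))
    (chartMetric_expand x₀ _ _ _)
  rw [chartMetricDeriv_expand_right hs, chartMetric_expand x₀ (c s) v' (w s),
    chartMetric_expand x₀ (c s) (v s) w']
  simp only [← Finset.sum_add_distrib]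
  refine Finset.sum_congr rfl fun i _ => Finset.sum_congr rfl fun j _ => ?_
  simp only [chartMetricDeriv, Function.comp, Pi.mul_apply]
  ring

/-- The transition map from the chart at `x₀` to the chart at `x₁`. -/
def chartTransition (x₀ x₁ : M) : Model m → Model m :=
  extChartAt (𝓡 m) x₁ ∘ (extChartAt (𝓡 m) x₀).symm

omit [RiemannianBundle (fun p : M => TangentSpace (𝓡 m) p)]
  [IsContMDiffRiemannianBundle (𝓡 m) ∞ (Model m) (fun p : M => TangentSpace (𝓡 m) p)] in
theorem contDiffAt_chartTransition {x₀ x₁ p : M} (hp : p ∈ (extChartAt (𝓡 m) x₀).source)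
    (hp₁ : p ∈ (extChartAt (𝓡 m) x₁).source) :
    ContDiffAt ℝ ∞ (chartTransition x₀ x₁) (extChartAt (𝓡 m) x₀ p) := by
  rw [← contMDiffAt_iff_contDiffAt]
  have hy := (extChartAt (𝓡 m) x₀).map_source hp
  have h1 : ContMDiffAt 𝓘(ℝ, Model m) (𝓡 m) ∞ (extChartAt (𝓡 m) x₀).symm
      (extChartAt (𝓡 m) x₀ p) :=
    (contMDiffOn_extChartAt_symm x₀).contMDiffAt ((isOpen_extChartAt_target x₀).mem_nhds hy)
  refine ContMDiffAt.comp _ ?_ h1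
  rw [(extChartAt (𝓡 m) x₀).left_inv hp]
  exact contMDiffAt_extChartAt' (by simpa using hp₁)

omit [IsContMDiffRiemannianBundle (𝓡 m) ∞ (Model m) (fun p : M => TangentSpace (𝓡 m) p)] in
/-- Transition maps are isometries for the metrics in the two charts. -/
theorem chartMetric_chartTransition {x₀ x₁ p : M} (hp : p ∈ (extChartAt (𝓡 m) x₀).source)
    (hp₁ : p ∈ (extChartAt (𝓡 m) x₁).source) (v w : Model m) :
    chartMetric x₁ (extChartAt (𝓡 m) x₁ p)
      (fderiv ℝ (chartTransition x₀ x₁) (extChartAt (𝓡 m) x₀ p) v)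
      (fderiv ℝ (chartTransition x₀ x₁) (extChartAt (𝓡 m) x₀ p) w) =
    chartMetric x₀ (extChartAt (𝓡 m) x₀ p) v w := by
  simp only [chartTransition, ← toCoord_ofCoord_eq_fderiv hp hp₁]
  rw [← inner_eq_chartMetric hp₁, inner_eq_chartMetric hp, toCoord_ofCoord hp, toCoord_ofCoord hp]

/-- The derivative of `chartMetric_chartTransition` with respect to the base point: second
derivatives of the transition map enter. -/
theorem chartMetricDeriv_chartTransition {x₀ x₁ p : M} (hp : p ∈ (extChartAt (𝓡 m) x₀).source)
    (hp₁ : p ∈ (extChartAt (𝓡 m) x₁).source) (u v w : Model m) :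
    chartMetricDeriv x₀ (extChartAt (𝓡 m) x₀ p) u v w =
      chartMetricDeriv x₁ (extChartAt (𝓡 m) x₁ p)
        (fderiv ℝ (chartTransition x₀ x₁) (extChartAt (𝓡 m) x₀ p) u)
        (fderiv ℝ (chartTransition x₀ x₁) (extChartAt (𝓡 m) x₀ p) v)
        (fderiv ℝ (chartTransition x₀ x₁) (extChartAt (𝓡 m) x₀ p) w) +
      chartMetric x₁ (extChartAt (𝓡 m) x₁ p)
        (fderiv ℝ (fderiv ℝ (chartTransition x₀ x₁)) (extChartAt (𝓡 m) x₀ p) u v)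
        (fderiv ℝ (chartTransition x₀ x₁) (extChartAt (𝓡 m) x₀ p) w) +
      chartMetric x₁ (extChartAt (𝓡 m) x₁ p)
        (fderiv ℝ (chartTransition x₀ x₁) (extChartAt (𝓡 m) x₀ p) v)
        (fderiv ℝ (fderiv ℝ (chartTransition x₀ x₁)) (extChartAt (𝓡 m) x₀ p) u w) := by
  have hφ := contDiffAt_chartTransition hp hp₁
  set y := extChartAt (𝓡 m) x₀ p with hydef
  have hy : y ∈ (extChartAt (𝓡 m) x₀).target := (extChartAt (𝓡 m) x₀).map_source hp
  have hφy : chartTransition x₀ x₁ y = extChartAt (𝓡 m) x₁ p := by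
    rw [chartTransition, Function.comp_apply, hydef, (extChartAt (𝓡 m) x₀).left_inv hp]
  have hl : HasDerivAt (fun t : ℝ => y + t • u) u 0 := by
    simpa using ((hasDerivAt_id (0 : ℝ)).smul_const u).const_add y
  have hl0 : y + (0 : ℝ) • u = y := by simp
  have h1 : HasDerivAt (fun t : ℝ => chartMetric x₀ (y + t • u) v w)
      (chartMetricDeriv x₀ y u v w) 0 :=
    (differentiableAt_chartMetric hy v w).hasFDerivAt.hasLineDerivAt u
  have hφd : HasDerivAt (fun t : ℝ => chartTransition x₀ x₁ (y + t • u))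
      (fderiv ℝ (chartTransition x₀ x₁) y u) 0 :=
    (hφ.differentiableAt (by simp)).hasFDerivAt.hasLineDerivAt u
  have hA : ∀ v, HasDerivAt (fun t : ℝ => fderiv ℝ (chartTransition x₀ x₁) (y + t • u) v)
      (fderiv ℝ (fderiv ℝ (chartTransition x₀ x₁)) y u v) 0 := by
    intro v
    have hd : DifferentiableAt ℝ (fderiv ℝ (chartTransition x₀ x₁)) y :=
      (hφ.fderiv_right (m := ∞) (by simp)).differentiableAt (by simp)
    have := HasDerivAt.clm_apply (hd.hasFDerivAt.hasLineDerivAt u) (hasDerivAt_const (0 : ℝ) v)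
    simpa only [map_zero, add_zero] using this
  have h2 := hasDerivWithinAt_chartMetric (x₀ := x₁) (I := univ) (s := 0)
    (c := fun t : ℝ => chartTransition x₀ x₁ (y + t • u))
    (v := fun t : ℝ => fderiv ℝ (chartTransition x₀ x₁) (y + t • u) v)
    (w := fun t : ℝ => fderiv ℝ (chartTransition x₀ x₁) (y + t • u) w)
    (by rw [hl0, hφy]; exact (extChartAt (𝓡 m) x₁).map_source hp₁)
    hφd.hasDerivWithinAt (hA v).hasDerivWithinAt (hA w).hasDerivWithinAt
  rw [hasDerivWithinAt_univ, hl0, hφy] at h2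
  -- both `h1` and `h2` differentiate `g_{y + t u}(v, w)`, in either chart, at `t = 0`
  refine (h1.congr_of_eventuallyEq ?_).unique h2
  have hopen : ∀ᶠ z in 𝓝 y, z ∈ (extChartAt (𝓡 m) x₀).target ∧
      (extChartAt (𝓡 m) x₀).symm z ∈ (extChartAt (𝓡 m) x₁).source := by
    refine ((isOpen_extChartAt_target x₀).eventually_mem hy).and ?_
    have hcont : ContinuousAt (extChartAt (𝓡 m) x₀).symm y := continuousAt_extChartAt_symm'' hy
    refine hcont.preimage_mem_nhds ((isOpen_extChartAt_source x₁).mem_nhds ?_)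
    rwa [hydef, (extChartAt (𝓡 m) x₀).left_inv hp]
  have hlc : Tendsto (fun t : ℝ => y + t • u) (𝓝 0) (𝓝 y) := by
    have := hl.continuousAt.tendsto
    rwa [hl0] at this
  filter_upwards [hlc.eventually hopen] with t ht
  have := chartMetric_chartTransition ((extChartAt (𝓡 m) x₀).map_target ht.1) ht.2 v w
  rw [(extChartAt (𝓡 m) x₀).right_inv ht.1] at this
  exact this

/-- The transformation law `Dφ Γ(u, v) = Γ'(Dφ u, Dφ v) + D²φ(u, v)` of the Christoffel symbols
under a transition map `φ`. Both sides satisfy the Koszul formula; the symmetry of `D²φ` is what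
makes the terms with second derivatives fit. -/
theorem fderiv_chartTransition_christoffelVec {x₀ x₁ p : M}
    (hp : p ∈ (extChartAt (𝓡 m) x₀).source)
    (hp₁ : p ∈ (extChartAt (𝓡 m) x₁).source) (u v : Model m) :
    fderiv ℝ (chartTransition x₀ x₁) (extChartAt (𝓡 m) x₀ p)
        (christoffelVec x₀ (extChartAt (𝓡 m) x₀ p) u v) =
      christoffelVec x₁ (extChartAt (𝓡 m) x₁ p)
        (fderiv ℝ (chartTransition x₀ x₁) (extChartAt (𝓡 m) x₀ p) u)
        (fderiv ℝ (chartTransition x₀ x₁) (extChartAt (𝓡 m) x₀ p) v) +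
      fderiv ℝ (fderiv ℝ (chartTransition x₀ x₁)) (extChartAt (𝓡 m) x₀ p) u v := by
  have hy := (extChartAt (𝓡 m) x₀).map_source hp
  have hy₁ := (extChartAt (𝓡 m) x₁).map_source hp₁
  have hsymm : ∀ a b, fderiv ℝ (fderiv ℝ (chartTransition x₀ x₁)) (extChartAt (𝓡 m) x₀ p) a b =
      fderiv ℝ (fderiv ℝ (chartTransition x₀ x₁)) (extChartAt (𝓡 m) x₀ p) b a := by
    intro a b
    exact (contDiffAt_chartTransition hp hp₁).isSymmSndFDerivAt
      (by rw [minSmoothness_of_isRCLikeNormedField]; exact ENat.LEInfty.out) a b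
  refine eq_of_chartMetric_eq hy₁ fun w' => ?_
  -- the differential of the transition map is onto, so vectors in its range suffice as tests
  obtain ⟨w, rfl⟩ : ∃ w, fderiv ℝ (chartTransition x₀ x₁) (extChartAt (𝓡 m) x₀ p) w = w' := by
    refine ⟨toCoord x₀ p (ofCoord x₁ p w'), ?_⟩
    rw [chartTransition, ← toCoord_ofCoord_eq_fderiv hp hp₁, ofCoord_toCoord hp,
      toCoord_ofCoord hp₁]
  rw [chartMetric_chartTransition hp hp₁, chartMetric_add_left]
  have e0 := chartMetric_christoffelVec hy u v w
  have e1 := chartMetric_christoffelVec hy₁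
    (fderiv ℝ (chartTransition x₀ x₁) (extChartAt (𝓡 m) x₀ p) u)
    (fderiv ℝ (chartTransition x₀ x₁) (extChartAt (𝓡 m) x₀ p) v)
    (fderiv ℝ (chartTransition x₀ x₁) (extChartAt (𝓡 m) x₀ p) w)
  rw [chartMetricDeriv_chartTransition hp hp₁, chartMetricDeriv_chartTransition hp hp₁,
    chartMetricDeriv_chartTransition hp hp₁] at e0
  rw [hsymm v u, hsymm w u, hsymm w v] at e0
  simp only [chartMetric_comm x₁ _ (fderiv ℝ (chartTransition x₀ x₁) _ _)
    (fderiv ℝ (fderiv ℝ (chartTransition x₀ x₁)) _ _ _)] at e0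
  linarith

end CovDeriv

/-! ### Vector fields along curves -/

section Along

variable {m : ℕ} {M : Type*} [TopologicalSpace M] [ChartedSpace (Model m) M]
  [IsManifold (𝓡 m) ∞ M]

section NoMetric

variable {γ : ℝ → M} {I : Set ℝ} {V W : (s : ℝ) → Tan (m := m) (γ s)}

theorem IsSmoothAlong.congr (hV : IsSmoothAlong γ I V) (h : ∀ s ∈ I, W s = V s) :
    IsSmoothAlong γ I W :=
  ContMDiffOn.congr hV fun s hs => by rw [h s hs]

theorem IsSmoothAlong.base (hV : IsSmoothAlong γ I V) : ContMDiffOn 𝓘(ℝ, ℝ) (𝓡 m) ∞ γ I :=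
  fun s hs => ((contMDiffWithinAt_tangent_iff (mem_extChartAt_source (γ s))).1 (hV s hs)).1

theorem IsSmoothAlong.coord (hV : IsSmoothAlong γ I V) {s : ℝ} (hs : s ∈ I) {x₀ : M}
    (hx : γ s ∈ (extChartAt (𝓡 m) x₀).source) :
    ContDiffWithinAt ℝ ∞ (fun t => toCoord x₀ (γ t) (V t)) I s :=
  ((contMDiffWithinAt_tangent_iff hx).1 (hV s hs)).2

theorem isSmoothAlong_sum_smul {ι : Type*} [Fintype ι] {a : ι → ℝ → ℝ}
    {X : ι → (s : ℝ) → Tan (m := m) (γ s)} (hγ : ContMDiffOn 𝓘(ℝ, ℝ) (𝓡 m) ∞ γ I)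
    (ha : ∀ i, ContDiffOn ℝ ∞ (a i) I) (hX : ∀ i, IsSmoothAlong γ I (X i)) :
    IsSmoothAlong γ I (fun s => ∑ i, a i s • X i s) := by
  intro s hs
  rw [contMDiffWithinAt_tangent_iff (mem_extChartAt_source (γ s))]
  refine ⟨hγ s hs, ?_⟩
  simp only [map_sum, map_smul]
  exact ContDiffWithinAt.sum fun i _ =>
    (ha i s hs).smul ((hX i).coord hs (mem_extChartAt_source (γ s)))

omit [IsManifold (𝓡 m) ∞ M] in
theorem eventually_mem_source (hγ : ContMDiffOn 𝓘(ℝ, ℝ) (𝓡 m) ∞ γ I) {s : ℝ} (hs : s ∈ I) {x₀ : M}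
    (hx : γ s ∈ (extChartAt (𝓡 m) x₀).source) :
    ∀ᶠ t in 𝓝[I] s, γ t ∈ (extChartAt (𝓡 m) x₀).source :=
  (hγ s hs).continuousWithinAt.preimage_mem_nhdsWithin ((isOpen_extChartAt_source x₀).mem_nhds hx)

theorem contDiffWithinAt_chart (hγ : ContMDiffOn 𝓘(ℝ, ℝ) (𝓡 m) ∞ γ I) {s : ℝ} (hs : s ∈ I)
    {x₀ : M} (hx : γ s ∈ (extChartAt (𝓡 m) x₀).source) :
    ContDiffWithinAt ℝ ∞ (fun t => extChartAt (𝓡 m) x₀ (γ t)) I s := by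
  rw [← contMDiffWithinAt_iff_contDiffWithinAt]
  exact (contMDiffAt_extChartAt' (by simpa using hx)).comp_contMDiffWithinAt s (hγ s hs)

theorem hasDerivWithinAt_chart (hγ : ContMDiffOn 𝓘(ℝ, ℝ) (𝓡 m) ∞ γ I) {s : ℝ} (hs : s ∈ I)
    {x₀ : M} (hx : γ s ∈ (extChartAt (𝓡 m) x₀).source) :
    HasDerivWithinAt (fun t => extChartAt (𝓡 m) x₀ (γ t))
      (derivWithin (fun t => extChartAt (𝓡 m) x₀ (γ t)) I s) I s :=
  ((contDiffWithinAt_chart hγ hs hx).differentiableWithinAt (by simp)).hasDerivWithinAt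

theorem IsSmoothAlong.hasDerivWithinAt_coord (hV : IsSmoothAlong γ I V) {s : ℝ} (hs : s ∈ I)
    {x₀ : M} (hx : γ s ∈ (extChartAt (𝓡 m) x₀).source) :
    HasDerivWithinAt (fun t => toCoord x₀ (γ t) (V t))
      (derivWithin (fun t => toCoord x₀ (γ t) (V t)) I s) I s :=
  ((hV.coord hs hx).differentiableWithinAt (by simp)).hasDerivWithinAt

theorem toCoord_injective {x₀ p : M} (hp : p ∈ (extChartAt (𝓡 m) x₀).source) :
    Function.Injective (toCoord (m := m) x₀ p) :=
  Function.LeftInverse.injective (ofCoord_toCoord hp)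

end NoMetric

variable [RiemannianBundle (fun p : M => TangentSpace (𝓡 m) p)]
  {γ : ℝ → M} {I : Set ℝ} {V W : (s : ℝ) → Tan (m := m) (γ s)}

/-- The covariant derivative `v' + Γ(c', v)` of a vector field along `γ`, in the chart at `x₀`. Here
`c` and `v` are the coordinates of the curve and the components of the field. -/
def chartCovDeriv (x₀ : M) (γ : ℝ → M) (I : Set ℝ) (V : (s : ℝ) → Tan (m := m) (γ s)) (s : ℝ) :
    Model m :=
  derivWithin (fun t => toCoord x₀ (γ t) (V t)) I s +
    christoffelVec x₀ (extChartAt (𝓡 m) x₀ (γ s))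
      (derivWithin (fun t => extChartAt (𝓡 m) x₀ (γ t)) I s) (toCoord x₀ (γ s) (V s))

theorem toLp_covDerivCoord (hγ : ContMDiffOn 𝓘(ℝ, ℝ) (𝓡 m) ∞ γ I) {s : ℝ} (hs : s ∈ I)
    {x₀ : M} (hx : γ s ∈ (extChartAt (𝓡 m) x₀).source) :
    WithLp.toLp 2 (covDerivCoord x₀ γ I V s) = chartCovDeriv x₀ γ I V s := by
  have h1 : coordAlong x₀ γ V s = toCoord x₀ (γ s) (V s) := mfderiv_extChartAt_apply hx _
  have h2 : coordAlong x₀ γ V =ᶠ[𝓝[I] s] fun t => toCoord x₀ (γ t) (V t) := by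
    filter_upwards [eventually_mem_source hγ hs hx] with t ht
    exact mfderiv_extChartAt_apply ht _
  ext k
  simp only [covDerivCoord, chartCovDeriv, christoffelVec, h1, h2.derivWithin_eq h1,
    PiLp.add_apply]

theorem toCoord_covDerivAlong_self (hγ : ContMDiffOn 𝓘(ℝ, ℝ) (𝓡 m) ∞ γ I) {s : ℝ} (hs : s ∈ I) :
    toCoord (γ s) (γ s) (covDerivAlong γ I V s) = chartCovDeriv (γ s) γ I V s := by
  have hx := mem_extChartAt_source (I := 𝓡 m) (γ s)
  rw [covDerivAlong, mfderiv_extChartAt_symm_apply hx, toCoord_ofCoord hx,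
    toLp_covDerivCoord hγ hs hx]

theorem covDerivAlong_congr (hγ : ContMDiffOn 𝓘(ℝ, ℝ) (𝓡 m) ∞ γ I) (h : ∀ s ∈ I, V s = W s)
    {s : ℝ} (hs : s ∈ I) : covDerivAlong γ I V s = covDerivAlong γ I W s := by
  apply toCoord_injective (mem_extChartAt_source (γ s))
  rw [toCoord_covDerivAlong_self hγ hs, toCoord_covDerivAlong_self hγ hs, chartCovDeriv,
    chartCovDeriv, h s hs,
    derivWithin_congr (f := fun t => toCoord (γ s) (γ t) (W t)) (fun t ht => by rw [h t ht])
      (by rw [h s hs])]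

/-- The Leibniz rule for linear combinations with variable coefficients. -/
theorem covDerivAlong_sum_smul {ι : Type*} [Fintype ι] {a : ι → ℝ → ℝ}
    {X : ι → (s : ℝ) → Tan (m := m) (γ s)} (hγ : ContMDiffOn 𝓘(ℝ, ℝ) (𝓡 m) ∞ γ I)
    (ha : ∀ i, ContDiffOn ℝ ∞ (a i) I) (hX : ∀ i, IsSmoothAlong γ I (X i))
    (hI : UniqueDiffOn ℝ I) {s : ℝ} (hs : s ∈ I) :
    covDerivAlong γ I (fun s => ∑ i, a i s • X i s) s =
      ∑ i, (derivWithin (a i) I s • X i s + a i s • covDerivAlong γ I (X i) s) := by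
  have hx := mem_extChartAt_source (I := 𝓡 m) (γ s)
  apply toCoord_injective hx
  have hd : HasDerivWithinAt (fun t => toCoord (γ s) (γ t) (∑ i, a i t • X i t))
      (∑ i, (a i s • derivWithin (fun t => toCoord (γ s) (γ t) (X i t)) I s +
        derivWithin (a i) I s • toCoord (γ s) (γ s) (X i s))) I s := by
    simp only [map_sum, map_smul]
    refine HasDerivWithinAt.fun_sum fun i _ => ?_
    exact (((ha i s hs).differentiableWithinAt (by simp)).hasDerivWithinAt).fun_smul
      ((hX i).hasDerivWithinAt_coord hs hx)
  have hΓ : ∀ (y u : Model m) (b : ι → ℝ) (v : ι → Model m), christoffelVec (γ s) y u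
      (∑ i, b i • v i) = ∑ i, b i • christoffelVec (γ s) y u (v i) := by
    intro y u b v
    exact (map_sum (AddMonoidHom.mk' (christoffelVec (γ s) y u)
      (christoffelVec_add_right (γ s) y u)) _ _).trans
      (Finset.sum_congr rfl fun i _ => christoffelVec_smul_right _ _ _ _ _)
  rw [toCoord_covDerivAlong_self hγ hs, chartCovDeriv, hd.derivWithin (hI s hs)]
  simp only [map_sum, map_add, map_smul, hΓ, ← Finset.sum_add_distrib,
    toCoord_covDerivAlong_self hγ hs]
  refine Finset.sum_congr rfl fun i _ => ?_
  rw [chartCovDeriv, smul_add]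
  abel

variable [IsContMDiffRiemannianBundle (𝓡 m) ∞ (Model m) (fun p : M => TangentSpace (𝓡 m) p)]

/-- The covariant derivative does not depend on the chart. `covDerivAlong` uses at each parameter
`s` the chart at `γ s`; this lemma replaces these by one fixed chart, in which the Frenet equations
are an ordinary differential equation. -/
theorem toCoord_covDerivAlong (hV : IsSmoothAlong γ I V) (hI : UniqueDiffOn ℝ I)
    {s : ℝ} (hs : s ∈ I) {x₀ : M} (hx : γ s ∈ (extChartAt (𝓡 m) x₀).source) :
    toCoord x₀ (γ s) (covDerivAlong γ I V s) = chartCovDeriv x₀ γ I V s := by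
  have hx₁ := mem_extChartAt_source (I := 𝓡 m) (γ s)
  have hγ := hV.base
  rw [← ofCoord_toCoord hx₁ (covDerivAlong γ I V s), toCoord_ofCoord_eq_fderiv hx₁ hx,
    toCoord_covDerivAlong_self hγ hs]
  have hφ := contDiffAt_chartTransition hx₁ hx
  change fderiv ℝ (chartTransition (γ s) x₀) _ _ = _
  have hc : derivWithin (fun t => extChartAt (𝓡 m) x₀ (γ t)) I s =
      fderiv ℝ (chartTransition (γ s) x₀) (extChartAt (𝓡 m) (γ s) (γ s))
        (derivWithin (fun t => extChartAt (𝓡 m) (γ s) (γ t)) I s) := by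
    have hd := (hφ.differentiableAt (by simp)).hasFDerivAt.comp_hasDerivWithinAt s
      (hasDerivWithinAt_chart hγ hs hx₁)
    rw [← hd.derivWithin (hI s hs)]
    refine Filter.EventuallyEq.derivWithin_eq ?_ ?_
    · filter_upwards [eventually_mem_source hγ hs hx₁] with t ht
      simp only [Function.comp_apply, chartTransition]
      rw [(extChartAt (𝓡 m) (γ s)).left_inv ht]
    · simp only [Function.comp_apply, chartTransition]
      rw [(extChartAt (𝓡 m) (γ s)).left_inv hx₁]
  have hv : derivWithin (fun t => toCoord x₀ (γ t) (V t)) I s =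
      fderiv ℝ (fderiv ℝ (chartTransition (γ s) x₀)) (extChartAt (𝓡 m) (γ s) (γ s))
        (derivWithin (fun t => extChartAt (𝓡 m) (γ s) (γ t)) I s)
        (toCoord (γ s) (γ s) (V s)) +
      fderiv ℝ (chartTransition (γ s) x₀) (extChartAt (𝓡 m) (γ s) (γ s))
        (derivWithin (fun t => toCoord (γ s) (γ t) (V t)) I s) := by
    have hA : DifferentiableAt ℝ (fderiv ℝ (chartTransition (γ s) x₀))
        (extChartAt (𝓡 m) (γ s) (γ s)) :=
      (hφ.fderiv_right (m := ∞) (by simp)).differentiableAt (by simp)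
    have hA' : HasDerivWithinAt
        (fun t => fderiv ℝ (chartTransition (γ s) x₀) (extChartAt (𝓡 m) (γ s) (γ t)))
        (fderiv ℝ (fderiv ℝ (chartTransition (γ s) x₀)) (extChartAt (𝓡 m) (γ s) (γ s))
          (derivWithin (fun t => extChartAt (𝓡 m) (γ s) (γ t)) I s)) I s :=
      hA.hasFDerivAt.comp_hasDerivWithinAt s (hasDerivWithinAt_chart hγ hs hx₁)
    have hd := HasDerivWithinAt.clm_apply hA' (hV.hasDerivWithinAt_coord hs hx₁)
    rw [← hd.derivWithin (hI s hs)]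
    have key : ∀ t, γ t ∈ (extChartAt (𝓡 m) (γ s)).source →
        γ t ∈ (extChartAt (𝓡 m) x₀).source → toCoord x₀ (γ t) (V t) =
        fderiv ℝ (chartTransition (γ s) x₀) (extChartAt (𝓡 m) (γ s) (γ t))
          (toCoord (γ s) (γ t) (V t)) := by
      intro t ht ht'
      rw [chartTransition, ← toCoord_ofCoord_eq_fderiv ht ht',
        ofCoord_toCoord ht]
    refine Filter.EventuallyEq.derivWithin_eq ?_ (key s hx₁ hx)
    filter_upwards [eventually_mem_source hγ hs hx₁, eventually_mem_source hγ hs hx] with t ht ht'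
    exact key t ht ht'
  have hVs : toCoord x₀ (γ s) (V s) = fderiv ℝ (chartTransition (γ s) x₀)
      (extChartAt (𝓡 m) (γ s) (γ s)) (toCoord (γ s) (γ s) (V s)) := by
    rw [chartTransition, ← toCoord_ofCoord_eq_fderiv hx₁ hx, ofCoord_toCoord hx₁]
  rw [chartCovDeriv, chartCovDeriv, hv, hc, hVs, map_add,
    fderiv_chartTransition_christoffelVec hx₁ hx]
  abel

/-- The Levi-Civita connection is metric along curves. -/
theorem hasDerivWithinAt_inner (hV : IsSmoothAlong γ I V) (hW : IsSmoothAlong γ I W)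
    {s : ℝ} (hs : s ∈ I) :
    HasDerivWithinAt (fun t => inner ℝ (V t) (W t))
      (inner ℝ (covDerivAlong γ I V s) (W s) + inner ℝ (V s) (covDerivAlong γ I W s)) I s := by
  have hx := mem_extChartAt_source (I := 𝓡 m) (γ s)
  have hγ := hV.base
  have h := hasDerivWithinAt_chartMetric (x₀ := γ s) ((extChartAt (𝓡 m) (γ s)).map_source hx)
    (hasDerivWithinAt_chart hγ hs hx) (hV.hasDerivWithinAt_coord hs hx)
    (hW.hasDerivWithinAt_coord hs hx)
  refine (h.congr_deriv ?_).congr_of_eventuallyEq ?_ (inner_eq_chartMetric hx _ _)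
  · rw [inner_eq_chartMetric hx, inner_eq_chartMetric hx, toCoord_covDerivAlong_self hγ hs,
      toCoord_covDerivAlong_self hγ hs, chartCovDeriv, chartCovDeriv, chartMetric_add_left,
      chartMetric_add_right, chartMetricDeriv_eq ((extChartAt (𝓡 m) (γ s)).map_source hx)]
    ring
  · filter_upwards [eventually_mem_source hγ hs hx] with t ht
    exact inner_eq_chartMetric ht _ _

theorem IsSmoothAlong.inner (hV : IsSmoothAlong γ I V) (hW : IsSmoothAlong γ I W) :
    ContDiffOn ℝ ∞ (fun t => inner ℝ (V t) (W t)) I := by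
  rw [← contMDiffOn_iff_contDiffOn]
  exact ContMDiffOn.inner_bundle hV hW

end Along

/-! ### The Frenet equations and the curvature system -/

section FrenetMatrix

variable {n : ℕ}

/-- The coefficient matrix `K` of the Frenet equations `∇_T X_i = ∑_j K_ij X_j`, with indices
starting at `0`: `K_{j-1,j} = κ_j` and `K_{i,i-1} = -κ_i`. -/
def frenetMatrix (n : ℕ) (κ : ℕ → ℝ → ℝ) (s : ℝ) (i j : Fin (n + 2)) : ℝ :=
  (if (j : ℕ) = i + 1 then κ j s else 0) - (if (i : ℕ) = j + 1 then κ i s else 0)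

theorem frenetMatrix_skew (κ : ℕ → ℝ → ℝ) (s : ℝ) (i j : Fin (n + 2)) :
    frenetMatrix n κ s j i = -frenetMatrix n κ s i j := by
  simp [frenetMatrix]

theorem frenetMatrix_zero_smul {W : Type*} [AddCommGroup W] [Module ℝ W] (κ : ℕ → ℝ → ℝ) (s : ℝ)
    (x : Fin (n + 2) → W) : ∑ j, frenetMatrix n κ s 0 j • x j = κ 1 s • x 1 := by
  rw [Finset.sum_eq_single 1]
  · simp [frenetMatrix]
  · intro j _ hj
    have : (j : ℕ) ≠ 1 := fun h => hj (Fin.ext (by simpa using h))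
    simp [frenetMatrix, this]
  · simp

theorem frenetMatrix_middle_smul {W : Type*} [AddCommGroup W] [Module ℝ W] (κ : ℕ → ℝ → ℝ) (s : ℝ)
    (x : Fin (n + 2) → W) (i : Fin n) : ∑ j, frenetMatrix n κ s i.castSucc.succ j • x j =
      -(κ (i + 1) s) • x i.castSucc.castSucc + κ (i + 2) s • x i.succ.succ := by
  rw [Finset.sum_eq_add i.castSucc.castSucc i.succ.succ]
  · have : (i : ℕ) ≠ i + 1 + 1 := by omega
    simp [frenetMatrix, this]
  · intro h
    have := congrArg Fin.val h
    simp at this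
    omega
  · intro j _ hj
    have h1 : (j : ℕ) ≠ i := fun h => hj.1 (Fin.ext (by simpa using h))
    have h2 : (j : ℕ) ≠ i + 1 + 1 := fun h => hj.2 (Fin.ext (by simpa using h))
    simp [frenetMatrix, h2, h1.symm]
  · simp
  · simp

theorem frenetMatrix_last_smul {W : Type*} [AddCommGroup W] [Module ℝ W] (κ : ℕ → ℝ → ℝ) (s : ℝ)
    (x : Fin (n + 2) → W) : ∑ j, frenetMatrix n κ s (Fin.last (n + 1)) j • x j =
      -(κ (n + 1) s) • x (Fin.last n).castSucc := by
  rw [Finset.sum_eq_single (Fin.last n).castSucc]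
  · have : n ≠ n + 1 + 1 := by omega
    simp [frenetMatrix, this]
  · intro j _ hj
    have h1 : (j : ℕ) ≠ n := fun h => hj (Fin.ext (by simpa using h))
    have h2 : (j : ℕ) ≠ n + 1 + 1 := by have := j.2; omega
    simp [frenetMatrix, h2, h1.symm]
  · simp

theorem sum_mul_frenetMatrix (κ a : ℕ → ℝ → ℝ) (s : ℝ) (j : Fin (n + 2)) :
    ∑ i : Fin (n + 2), a i s * frenetMatrix n κ s i j =
      (if 1 ≤ (j : ℕ) then a (j - 1) s * κ j s else 0) -
        (if (j : ℕ) ≤ n then a (j + 1) s * κ (j + 1) s else 0) := by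
  simp only [frenetMatrix, mul_sub, Finset.sum_sub_distrib]
  congr 1
  · split_ifs with h
    · rw [Finset.sum_eq_single ⟨j - 1, by omega⟩]
      · have : (j : ℕ) = j - 1 + 1 := by omega
        simp [← this]
      · intro i _ hi
        have : (j : ℕ) ≠ i + 1 := fun h => hi (Fin.ext (by simp; omega))
        simp [this]
      · simp
    · refine Finset.sum_eq_zero fun i _ => ?_
      have : (j : ℕ) ≠ i + 1 := by omega
      simp [this]
  · split_ifs with h
    · rw [Finset.sum_eq_single ⟨j + 1, by omega⟩]
      · simp
      · intro i _ hi
        have : (i : ℕ) ≠ j + 1 := fun h => hi (Fin.ext (by simp; omega))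
        simp [this]
      · simp
    · refine Finset.sum_eq_zero fun i _ => ?_
      have : (i : ℕ) ≠ j + 1 := by omega
      simp [this]

/-- The components `λ_0, cos θ, λ_1, λ_2, …` of `λ_0 T + cos θ N + ∑ λ_i B_i` with respect to the
Frenet frame, in the order of the frame. -/
def frameCoeff (θ : ℝ → ℝ) (lam : ℕ → ℝ → ℝ) : ℕ → ℝ → ℝ
  | 0 => lam 0
  | 1 => fun s => Real.cos (θ s)
  | i + 2 => lam (i + 1)

theorem sum_frameCoeff_sq (θ : ℝ → ℝ) (lam : ℕ → ℝ → ℝ) (s : ℝ) :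
    ∑ i : Fin (n + 2), frameCoeff θ lam i s ^ 2 =
      Real.cos (θ s) ^ 2 + ∑ i ∈ Finset.range (n + 1), lam i s ^ 2 := by
  rw [Fin.sum_univ_succ, Fin.sum_univ_succ, Finset.sum_range_succ', Finset.sum_range]
  simp [frameCoeff]
  ring

theorem contDiffOn_frameCoeff {I : Set ℝ} {θ : ℝ → ℝ} {lam : ℕ → ℝ → ℝ}
    (hθ : ContDiffOn ℝ ∞ θ I) (hlam : ∀ i ≤ n, ContDiffOn ℝ ∞ (lam i) I) (i : Fin (n + 2)) :
    ContDiffOn ℝ ∞ (frameCoeff θ lam i) I := by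
  obtain ⟨i, hi⟩ := i
  match i, hi with
  | 0, _ => exact hlam 0 (by omega)
  | 1, _ => exact Real.contDiff_cos.comp_contDiffOn hθ
  | i + 2, h => exact hlam (i + 1) (by omega)

/-- In terms of the components `a_j` of the field, the system is the single family of equations
`a_j' + ∑_i a_i K_ij = f δ_{j0} - f λ_0 a_j`. The left hand side is the `j`-th component of `∇_T V`,
the right hand side that of `f T + ω(T) V` for `ω(T) = -f λ_0`. -/
theorem curvatureSystem_iff {I : Set ℝ} (hI : UniqueDiffOn ℝ I) {f θ : ℝ → ℝ}
    {lam κ : ℕ → ℝ → ℝ} (hθ : ContDiffOn ℝ ∞ θ I) :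
    CurvatureSystem n I f θ lam κ ↔ ∀ s ∈ I, ∀ j : Fin (n + 2),
      derivWithin (frameCoeff θ lam j) I s +
        ∑ i : Fin (n + 2), frameCoeff θ lam i s * frenetMatrix n κ s i j =
      (if j = 0 then f s else 0) - f s * lam 0 s * frameCoeff θ lam j s := by
  have hcos : ∀ s ∈ I, derivWithin (fun s => Real.cos (θ s)) I s =
      -Real.sin (θ s) * derivWithin θ I s := fun s hs =>
    (((hθ s hs).differentiableWithinAt (by simp)).hasDerivWithinAt.cos).derivWithin (hI s hs)
  simp only [sum_mul_frenetMatrix]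
  constructor
  · intro h s hs j
    obtain ⟨j, hj⟩ := j
    match j, hj with
    | 0, hj =>
      have := h.eq_T s hs
      simp [frameCoeff]
      linarith
    | 1, hj =>
      have := h.eq_N s hs
      simp [frameCoeff, hcos s hs]
      split_ifs at this ⊢ <;> linarith
    | 2, hj =>
      have := h.eq_B_first (by omega) s hs
      have e : ((⟨2, hj⟩ : Fin (n + 2)) = 0) = False := by simp [Fin.ext_iff]
      simp [frameCoeff, e]
      split_ifs at this ⊢ <;> linarith
    | j + 3, hj =>
      have e : ((⟨j + 3, hj⟩ : Fin (n + 2)) = 0) = False := by simp [Fin.ext_iff]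
      simp only [frameCoeff, e]
      -- the component `j + 3 = n + 1` belongs to the last vector of the frame
      by_cases hjn : j + 3 ≤ n
      · have := h.eq_B_middle (j + 2) (by omega) (by omega) s hs
        simp [hjn] at this ⊢
        linarith
      · obtain rfl : n = j + 2 := by omega
        have := h.eq_B_last (by omega) s hs
        simp at this ⊢
        linarith
  · intro h
    refine ⟨fun s hs => ?_, fun s hs => ?_, fun hn s hs => ?_, fun i hi hin s hs => ?_,
      fun hn s hs => ?_⟩
    · have := h s hs ⟨0, by omega⟩
      simp [frameCoeff] at this
      linarith
    · have := h s hs ⟨1, by omega⟩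
      simp [frameCoeff, hcos s hs] at this
      split_ifs at this ⊢ <;> linarith
    · have := h s hs ⟨2, by omega⟩
      have e : ((⟨2, by omega⟩ : Fin (n + 2)) = 0) = False := by simp [Fin.ext_iff]
      simp [frameCoeff, e] at this
      split_ifs at this ⊢ <;> linarith
    · obtain ⟨j, rfl⟩ : ∃ j, i = j + 2 := ⟨i - 2, by omega⟩
      have := h s hs ⟨j + 3, by omega⟩
      have e : ((⟨j + 3, by omega⟩ : Fin (n + 2)) = 0) = False := by simp [Fin.ext_iff]
      simp [frameCoeff, e, show j + 3 ≤ n by omega] at this ⊢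
      linarith
    · obtain ⟨j, rfl⟩ : ∃ j, n = j + 2 := ⟨n - 2, by omega⟩
      have := h s hs ⟨j + 3, by omega⟩
      have e : ((⟨j + 3, by omega⟩ : Fin (j + 2 + 2)) = 0) = False := by simp [Fin.ext_iff]
      simp [frameCoeff, e] at this ⊢
      linarith

theorem Set.OrdConnected.uniqueDiffOn {I : Set ℝ} (hI : I.OrdConnected) (hn : I.Nontrivial) :
    UniqueDiffOn ℝ I := by
  refine uniqueDiffOn_convex hI.convex ?_
  obtain ⟨a, ha, b, hb, hab⟩ := hn.exists_lt
  obtain ⟨c, hc⟩ := exists_between hab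
  exact ⟨c, interior_maximal (Ioo_subset_Icc_self.trans (hI.out ha hb)) isOpen_Ioo hc⟩

theorem Orthonormal.sum_inner_smul_eq {W : Type*} [NormedAddCommGroup W] [InnerProductSpace ℝ W]
    {ι : Type*} [Fintype ι] [Nonempty ι] {x : ι → W} (hx : Orthonormal ℝ x)
    (hW : Fintype.card ι = Module.finrank ℝ W) (v : W) :
    ∑ i, inner ℝ v (x i) • x i = v := by
  have h := (OrthonormalBasis.mk hx
    (hx.linearIndependent.span_eq_top_of_card_eq_finrank hW).ge).sum_repr' v
  simp only [OrthonormalBasis.coe_mk] at h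
  simpa only [real_inner_comm] using h

end FrenetMatrix

/-! ### Torse-forming fields along a Frenet curve -/

section Characterization

variable {n : ℕ} {M : Type*} [TopologicalSpace M] [ChartedSpace (Model (n + 2)) M]
  [IsManifold (𝓡 (n + 2)) ∞ M] [RiemannianBundle (fun p : M => TangentSpace (𝓡 (n + 2)) p)]
  {o : ManifoldOrientation (n + 2) M} {I : Set ℝ} {γ : ℝ → M}
  {X : Fin (n + 2) → (s : ℝ) → Tan (m := n + 2) (γ s)} {κ : ℕ → ℝ → ℝ}

omit [IsManifold (𝓡 (n + 2)) ∞ M] [RiemannianBundle (fun p : M => TangentSpace (𝓡 (n + 2)) p)] in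
theorem finrank_tan (p : M) : Module.finrank ℝ (Tan (m := n + 2) p) = n + 2 :=
  finrank_euclideanSpace_fin (𝕜 := ℝ) (n := n + 2)

omit [IsManifold (𝓡 (n + 2)) ∞ M] [RiemannianBundle (fun p : M => TangentSpace (𝓡 (n + 2)) p)] in
theorem frameCombination_eq_sum (θ : ℝ → ℝ) (lam : ℕ → ℝ → ℝ) (s : ℝ) :
    frameCombination X θ lam s = ∑ i : Fin (n + 2), frameCoeff θ lam i s • X i s := by
  rw [Fin.sum_univ_succ, Fin.sum_univ_succ, frameCombination, add_assoc]
  rfl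

theorem IsFrenetFrame.covDerivAlong_eq (h : IsFrenetFrame o γ I X κ) {s : ℝ} (hs : s ∈ I)
    (i : Fin (n + 2)) : covDerivAlong γ I (X i) s = ∑ j, frenetMatrix n κ s i j • X j s := by
  induction i using Fin.cases with
  | zero => rw [frenetMatrix_zero_smul κ s (fun j => X j s), h.frenet_first s hs]
  | succ i =>
    induction i using Fin.lastCases with
    | last =>
      rw [Fin.succ_last, frenetMatrix_last_smul κ s (fun j => X j s)]
      exact h.frenet_last s hs
    | cast i => rw [frenetMatrix_middle_smul κ s (fun j => X j s), h.frenet_middle i s hs]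

/-- The components of the covariant derivative of a field given in a frame satisfying the Frenet
equations. -/
theorem covDerivAlong_sum_smul_frame (hγ : ContMDiffOn 𝓘(ℝ, ℝ) (𝓡 (n + 2)) ∞ γ I)
    (hX : ∀ i, IsSmoothAlong γ I (X i)) (hI : UniqueDiffOn ℝ I)
    (hframe : ∀ s ∈ I, ∀ i, covDerivAlong γ I (X i) s = ∑ j, frenetMatrix n κ s i j • X j s)
    {a : Fin (n + 2) → ℝ → ℝ} (ha : ∀ i, ContDiffOn ℝ ∞ (a i) I) {s : ℝ} (hs : s ∈ I) :
    covDerivAlong γ I (fun s => ∑ i, a i s • X i s) s =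
      ∑ j, (derivWithin (a j) I s + ∑ i, a i s * frenetMatrix n κ s i j) • X j s := by
  rw [covDerivAlong_sum_smul hγ ha hX hI hs]
  simp only [hframe s hs, Finset.sum_add_distrib, add_smul, Finset.smul_sum, Finset.sum_smul,
    smul_smul]
  rw [Finset.sum_comm (f := fun i j => (a i s * frenetMatrix n κ s i j) • X j s)]

theorem inner_sum_smul_frame {W : Type*} [NormedAddCommGroup W] [InnerProductSpace ℝ W]
    {ι : Type*} [Fintype ι] {x : ι → W} (hx : Orthonormal ℝ x) (a : ι → ℝ) (j : ι) :
    inner ℝ (∑ i, a i • x i) (x j) = a j := by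
  rw [real_inner_comm, hx.inner_right_fintype]

theorem inner_self_sum_smul_frame {W : Type*} [NormedAddCommGroup W] [InnerProductSpace ℝ W]
    {ι : Type*} [Fintype ι] {x : ι → W} (hx : Orthonormal ℝ x) (a : ι → ℝ) :
    inner ℝ (∑ i, a i • x i) (∑ i, a i • x i) = ∑ i, a i ^ 2 := by
  rw [sum_inner]
  refine Finset.sum_congr rfl fun i _ => ?_
  rw [real_inner_smul_left, hx.inner_right_fintype, sq]

variable {V : (s : ℝ) → Tan (m := n + 2) (γ s)} {f : ℝ → ℝ}
  {om : (s : ℝ) → Tan (m := n + 2) (γ s) →L[ℝ] ℝ} {θ : ℝ → ℝ}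
  [IsContMDiffRiemannianBundle (𝓡 (n + 2)) ∞ (Model (n + 2))
      (fun p : M => TangentSpace (𝓡 (n + 2)) p)]

/-- Differentiating `⟨V, V⟩ = 1` determines the generating form on `T`. -/
theorem form_velocity_eq_of_isTorseForming (hI : UniqueDiffOn ℝ I)
    (hV : IsTorseForming γ I V f om) (hunit : ∀ s ∈ I, ‖V s‖ = 1) {s : ℝ} (hs : s ∈ I) :
    om s (velocity γ I s) = -f s * inner ℝ (V s) (velocity γ I s) := by
  have h := (hasDerivWithinAt_inner hV.smooth hV.smooth hs).derivWithin (hI s hs)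
  have h1 : ∀ s ∈ I, inner ℝ (V s) (V s) = (1 : ℝ) := fun s hs => by
    rw [real_inner_self_eq_norm_sq, hunit s hs, one_pow]
  rw [derivWithin_congr h1 (h1 s hs), derivWithin_fun_const, hV.eq s hs, inner_add_left,
    inner_add_right, real_inner_smul_left, real_inner_smul_left, real_inner_smul_right,
    real_inner_smul_right, h1 s hs, real_inner_comm (V s)] at h
  simp at h
  linarith

/-- The coefficients are the inner products with the frame; the one with `N` is `cos θ` because `θ`
is the angle. The system is the equation of torse-forming fields, read in the frame. -/
theorem exists_frameCoeff_of_isTorseForming (hI : UniqueDiffOn ℝ I)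
    (hX : IsFrenetFrame o γ I X κ) (hPA : IsPACurve γ I (X 1) V θ)
    (hV : IsTorseForming γ I V f om) :
    ∃ lam : ℕ → ℝ → ℝ, (∀ i ≤ n, ContDiffOn ℝ ∞ (lam i) I) ∧
      (∀ s ∈ I, V s = frameCombination X θ lam s) ∧ UnitCoeff n I θ lam ∧
      CurvatureSystem n I f θ lam κ := by
  set a : Fin (n + 2) → ℝ → ℝ := fun i s => inner ℝ (V s) (X i s) with ha
  -- the component along `N = X 1` is skipped, and the values for `i > n` play no role
  set lam : ℕ → ℝ → ℝ := fun i => if i = 0 then a 0 else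
    if h : i + 1 < n + 2 then a ⟨i + 1, h⟩ else 0 with hlam
  have hsm : ∀ i, ContDiffOn ℝ ∞ (a i) I := fun i => hV.smooth.inner (hX.smooth_frame i)
  have hlsm : ∀ i ≤ n, ContDiffOn ℝ ∞ (lam i) I := by
    intro i hi
    simp only [hlam]
    split_ifs with h0 h1
    · exact hsm _
    · exact hsm _
    · omega
  have hcoef : ∀ s ∈ I, ∀ i : Fin (n + 2), frameCoeff θ lam i s = a i s := by
    intro s hs i
    obtain ⟨i, hi⟩ := i
    match i, hi with
    | 0, _ => simp [frameCoeff, hlam]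
    | 1, _ =>
      have h1 : ‖X 1 s‖ = 1 := (hX.orthonormal s hs).1 1
      have := InnerProductGeometry.cos_angle (V s) (X 1 s)
      rw [hPA.angle_eq s hs, hPA.unit s hs, h1] at this
      simpa [frameCoeff] using this
    | i + 2, h =>
      have : i < n := by omega
      simp [frameCoeff, hlam, this]
  have hVs : ∀ s ∈ I, V s = frameCombination X θ lam s := by
    intro s hs
    rw [frameCombination_eq_sum]
    simp only [hcoef s hs]
    exact ((hX.orthonormal s hs).sum_inner_smul_eq (by rw [finrank_tan]; simp) (V s)).symm
  have hγ := hPA.frenet.smooth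
  refine ⟨lam, hlsm, hVs, fun s hs => ?_, ?_⟩
  · rw [← sum_frameCoeff_sq, ← inner_self_sum_smul_frame (hX.orthonormal s hs),
      ← frameCombination_eq_sum, ← hVs s hs, real_inner_self_eq_norm_sq, hPA.unit s hs, one_pow]
  · rw [curvatureSystem_iff hI hPA.smooth_angle]
    intro s hs j
    have hder := covDerivAlong_congr (W := fun s => ∑ i : Fin (n + 2), frameCoeff θ lam i s • X i s)
      hγ (fun s hs => (hVs s hs).trans (frameCombination_eq_sum θ lam s)) hs
    rw [covDerivAlong_sum_smul_frame hγ hX.smooth_frame hI (fun s hs => hX.covDerivAlong_eq hs)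
      (contDiffOn_frameCoeff hPA.smooth_angle hlsm) hs, hV.eq s hs] at hder
    have h := congrArg (fun v => inner ℝ v (X j s)) hder
    simp only [inner_sum_smul_frame (hX.orthonormal s hs)] at h
    rw [← h, inner_add_left, real_inner_smul_left, real_inner_smul_left,
      form_velocity_eq_of_isTorseForming hI hV hPA.unit hs, ← hX.tangent s hs, hcoef s hs,
      orthonormal_iff_ite.1 (hX.orthonormal s hs)]
    have : lam 0 s = a 0 s := by simp [hlam]
    rw [this]
    simp only [ha, eq_comm (a := (0 : Fin (n + 2)))]
    split_ifs <;> ring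

section Converse

omit [IsContMDiffRiemannianBundle (𝓡 (n + 2)) ∞ (Model (n + 2))
      (fun p : M => TangentSpace (𝓡 (n + 2)) p)]

theorem inner_frame_of_eq_frameCombination (hX : IsFrenetFrame o γ I X κ) {lam : ℕ → ℝ → ℝ}
    (hV : ∀ s ∈ I, V s = frameCombination X θ lam s) {s : ℝ} (hs : s ∈ I) (j : Fin (n + 2)) :
    inner ℝ (V s) (X j s) = frameCoeff θ lam j s := by
  rw [hV s hs, frameCombination_eq_sum, inner_sum_smul_frame (hX.orthonormal s hs)
    (fun i : Fin (n + 2) => frameCoeff θ lam i s)]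

theorem isSmoothAlong_of_eq_frameCombination (hX : IsFrenetFrame o γ I X κ)
    (hθ : ContDiffOn ℝ ∞ θ I) {lam : ℕ → ℝ → ℝ} (hlam : ∀ i ≤ n, ContDiffOn ℝ ∞ (lam i) I)
    (hV : ∀ s ∈ I, V s = frameCombination X θ lam s) : IsSmoothAlong γ I V :=
  (isSmoothAlong_sum_smul (hX.smooth_frame 0).base (contDiffOn_frameCoeff hθ hlam)
    hX.smooth_frame).congr fun s hs => (hV s hs).trans (frameCombination_eq_sum θ lam s)

theorem isPACurve_of_eq_frameCombination
    (hγ : IsFrenetCurve (m := n + 2) γ I) (hunit : IsArcLength (m := n + 2) γ I)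
    (hX : IsFrenetFrame o γ I X κ) (hθ : ContDiffOn ℝ ∞ θ I)
    (hθI : ∀ s ∈ I, θ s ∈ Icc 0 Real.pi) {lam : ℕ → ℝ → ℝ}
    (hlam : ∀ i ≤ n, ContDiffOn ℝ ∞ (lam i) I) (hV : ∀ s ∈ I, V s = frameCombination X θ lam s)
    (hcoef : UnitCoeff n I θ lam) : IsPACurve γ I (X 1) V θ := by
  have hVunit : ∀ s ∈ I, ‖V s‖ = 1 := by
    intro s hs
    rw [← sq_eq_sq₀ (norm_nonneg _) zero_le_one, one_pow, ← real_inner_self_eq_norm_sq,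
      hV s hs, frameCombination_eq_sum, inner_self_sum_smul_frame (hX.orthonormal s hs)
        (fun i : Fin (n + 2) => frameCoeff θ lam i s), sum_frameCoeff_sq, ← hcoef s hs]
  refine ⟨hγ, hunit, isSmoothAlong_of_eq_frameCombination hX hθ hlam hV, fun s hs h0 => ?_, hθ,
    hθI, hVunit, fun s hs => ?_⟩
  · have := hVunit s hs
    rw [h0, norm_zero] at this
    exact zero_ne_one this
  · have h1 : ‖X 1 s‖ = 1 := (hX.orthonormal s hs).1 1
    rw [InnerProductGeometry.angle, inner_frame_of_eq_frameCombination hX hV hs, hVunit s hs, h1]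
    simpa [frameCoeff] using Real.arccos_cos (hθI s hs).1 (hθI s hs).2

theorem isTorseForming_of_curvatureSystem (hI : UniqueDiffOn ℝ I)
    (hX : IsFrenetFrame o γ I X κ) (hf : ContDiffOn ℝ ∞ f I) (hθ : ContDiffOn ℝ ∞ θ I)
    {lam : ℕ → ℝ → ℝ} (hlam : ∀ i ≤ n, ContDiffOn ℝ ∞ (lam i) I)
    (hV : ∀ s ∈ I, V s = frameCombination X θ lam s) (hsys : CurvatureSystem n I f θ lam κ)
    (hom : ∀ s ∈ I, om s (velocity γ I s) = -f s * inner ℝ (V s) (velocity γ I s)) :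
    IsTorseForming γ I V f om := by
  have hγ := (hX.smooth_frame 0).base
  have hVsum : ∀ s ∈ I, V s = ∑ i : Fin (n + 2), frameCoeff θ lam i s • X i s := fun s hs =>
    (hV s hs).trans (frameCombination_eq_sum θ lam s)
  have hom' : ∀ s ∈ I, om s (velocity γ I s) = -f s * lam 0 s := fun s hs => by
    rw [hom s hs, ← hX.tangent s hs, inner_frame_of_eq_frameCombination hX hV hs]
    rfl
  refine ⟨isSmoothAlong_of_eq_frameCombination hX hθ hlam hV, hf,
    (hf.neg.mul (hlam 0 (by omega))).congr hom', fun s hs => ?_⟩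
  rw [covDerivAlong_congr hγ hVsum hs, covDerivAlong_sum_smul_frame hγ
    hX.smooth_frame hI (fun s hs => hX.covDerivAlong_eq hs) (contDiffOn_frameCoeff hθ hlam) hs]
  simp only [(curvatureSystem_iff hI hθ).1 hsys s hs, sub_smul, Finset.sum_sub_distrib]
  rw [hom' s hs, hVsum s hs, ← hX.tangent s hs, Finset.smul_sum]
  simp [smul_smul, ite_smul, sub_eq_add_neg]

end Converse

end Characterization

/-! ### Integral curves, positive bases and Gram matrices -/

section Aux

/-- Local existence and smoothness of integral curves that stay in the domain of a smooth vector
field. -/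
theorem exists_smooth_integralCurve {E : Type*} [NormedAddCommGroup E] [NormedSpace ℝ E]
    [CompleteSpace E] {F : E → E} {Ω : Set E} (hΩ : IsOpen Ω) (hF : ContDiffOn ℝ ∞ F Ω)
    {z₀ : E} (hz₀ : z₀ ∈ Ω) (t₀ : ℝ) :
    ∃ ε > 0, ∃ α : ℝ → E, α t₀ = z₀ ∧ ContDiffOn ℝ ∞ α (Ioo (t₀ - ε) (t₀ + ε)) ∧
      ∀ t ∈ Ioo (t₀ - ε) (t₀ + ε), α t ∈ Ω ∧ HasDerivAt α (F (α t)) t := by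
  have hF₀ : ContDiffAt ℝ 1 F z₀ :=
    (hF.contDiffAt (hΩ.mem_nhds hz₀)).of_le (by exact ENat.LEInfty.out)
  obtain ⟨α, hα₀, ε₁, hε₁, hα⟩ :=
    hF₀.exists_forall_mem_closedBall_exists_eq_forall_mem_Ioo_hasDerivAt₀ t₀
  have hcont : ContinuousAt α t₀ := (hα t₀ ⟨by linarith, by linarith⟩).continuousAt
  obtain ⟨ε₂, hε₂, hmem⟩ := Metric.eventually_nhds_iff.1
    (hcont.eventually_mem (hΩ.mem_nhds (hα₀ ▸ hz₀)))
  -- halving makes the closed interval, on which smoothness is available, part of the open one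
  set ε := min ε₁ ε₂ / 2 with hε
  have hpos : 0 < min ε₁ ε₂ := lt_min hε₁ hε₂
  have h1 : ε < ε₁ := by have := min_le_left ε₁ ε₂; linarith
  have h2 : ε < ε₂ := by have := min_le_right ε₁ ε₂; linarith
  have hΩmem : ∀ t ∈ Icc (t₀ - ε) (t₀ + ε), α t ∈ Ω := by
    intro t ht
    refine hmem ?_
    rw [Real.dist_eq, abs_lt]
    constructor <;> linarith [ht.1, ht.2]
  have hder : ∀ t ∈ Icc (t₀ - ε) (t₀ + ε), HasDerivAt α (F (α t)) t := fun t ht =>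
    hα t ⟨by linarith [ht.1], by linarith [ht.2]⟩
  refine ⟨ε, by linarith, α, hα₀, ?_, fun t ht => ?_⟩
  · refine (ODE.contDiffOn_enat_Icc_of_hasDerivWithinAt (f := fun _ => F) (u := Ω) (n := ⊤) ?_
      (fun t ht => (hder t ht).hasDerivWithinAt) hΩmem).mono Ioo_subset_Icc_self
    exact hF.comp contDiffOn_snd fun z hz => hz.2
  · exact ⟨hΩmem t (Ioo_subset_Icc_self ht), hder t (Ioo_subset_Icc_self ht)⟩

theorem isPositiveBasis_of_det_pos {k : ℕ} {W : Type*} [AddCommGroup W] [Module ℝ W]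
    (b : Module.Basis (Fin k) ℝ W) {w : Fin k → W} (hw : 0 < b.det w) :
    IsPositiveBasis b.orientation w := by
  obtain ⟨hli, hsp⟩ := (Module.Basis.is_basis_iff_det b).2 (isUnit_iff_ne_zero.2 hw.ne')
  have hb : ⇑(Module.Basis.mk hli hsp.ge) = w := Module.Basis.coe_mk hli hsp.ge
  refine ⟨Module.Basis.mk hli hsp.ge, fun i => by rw [hb], ?_⟩
  rw [eq_comm, Module.Basis.orientation_eq_iff_det_pos, hb]
  exact hw

/-- Positivity of a basis is an open condition, since the determinant is continuous. -/
theorem IsPositiveBasis.eventually {k d : ℕ} {o : Orientation ℝ (Model d) (Fin k)}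
    {x : Fin k → ℝ → Model d} {s : ℝ} (hx : ∀ i, ContinuousAt (x i) s)
    (h : IsPositiveBasis o fun i => x i s) : ∀ᶠ t in 𝓝 s, IsPositiveBasis o fun i => x i t := by
  obtain ⟨b, hb, rfl⟩ := h
  have hb' : (fun i => x i s) = b := funext fun i => (hb i).symm
  have h1 : 0 < b.det fun i => x i s := by rw [hb', b.det_self]; exact one_pos
  have hcont : ContinuousAt (fun t => b.det fun i => x i t) s := by
    simp only [Module.Basis.det_apply]
    have : ContinuousAt (fun t => b.toMatrix fun i => x i t) s := by
      refine continuousAt_pi.2 fun i => continuousAt_pi.2 fun j => ?_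
      exact (LinearMap.continuous_of_finiteDimensional (b.coord i)).continuousAt.comp (hx j)
    exact (continuous_id.matrix_det).continuousAt.comp this
  filter_upwards [hcont.eventually (lt_mem_nhds h1)] with t ht
  exact isPositiveBasis_of_det_pos b ht

theorem exists_forall_mem_Ioo_of_eventually {s₀ ε : ℝ} (hε : 0 < ε) {p : ℝ → Prop}
    (h : ∀ᶠ t in 𝓝 s₀, p t) : ∃ ε' > 0, ε' ≤ ε ∧ ∀ t ∈ Ioo (s₀ - ε') (s₀ + ε'), p t := by
  obtain ⟨ε₂, hε₂, hp⟩ := Metric.eventually_nhds_iff.1 h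
  refine ⟨min ε ε₂, lt_min hε hε₂, min_le_left _ _, fun t ht => hp ?_⟩
  rw [Real.dist_eq, abs_lt]
  have := min_le_right ε ε₂
  constructor <;> linarith [ht.1, ht.2]

end Aux

section Gram

/-- A matrix function with `G' = K G + G Kᵀ`, where `K` is skew, stays the identity if it is so at
one point: for `H = G - 1` again `H' = K H + H Kᵀ`, and by skewness `∑ H_ij²` has
derivative zero. -/
theorem gram_eq_one_of_skew {ι : Type*} [Fintype ι] [DecidableEq ι] {J : Set ℝ} (hJ : IsOpen J)
    (hJc : IsPreconnected J) {K G : ℝ → ι → ι → ℝ} (hK : ∀ s i j, K s j i = -K s i j)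
    (hG : ∀ s ∈ J, ∀ i j, HasDerivAt (fun t => G t i j)
      (∑ k, K s i k * G s k j + ∑ k, K s j k * G s i k) s)
    {s₀ : ℝ} (hs₀ : s₀ ∈ J) (h₀ : ∀ i j, G s₀ i j = if i = j then 1 else 0) :
    ∀ s ∈ J, ∀ i j, G s i j = if i = j then 1 else 0 := by
  set H : ℝ → ι → ι → ℝ := fun t i j => G t i j - if i = j then 1 else 0 with hH
  have hH' : ∀ s ∈ J, ∀ i j, HasDerivAt (fun t => H t i j)
      (∑ k, K s i k * H s k j + ∑ k, K s j k * H s i k) s := by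
    intro s hs i j
    refine ((hG s hs i j).sub_const _).congr_deriv ?_
    have : K s i j + K s j i = 0 := by rw [hK s i j]; ring
    simp only [hH, mul_sub, Finset.sum_sub_distrib, mul_ite, mul_one, mul_zero,
      Finset.sum_ite_eq, Finset.sum_ite_eq', Finset.mem_univ, if_true]
    linarith
  have hQ : ∀ s ∈ J, HasDerivAt (fun t => ∑ i, ∑ j, H t i j ^ 2) 0 s := by
    intro s hs
    have h1 := HasDerivAt.fun_sum (u := Finset.univ) fun i _ =>
      HasDerivAt.fun_sum (u := Finset.univ) fun j _ => (hH' s hs i j).fun_pow 2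
    refine h1.congr_deriv ?_
    have skew : ∀ B : ι → ι → ℝ, (∀ i k, B i k = -B k i) → ∑ i, ∑ k, B i k = 0 := by
      intro B hB
      have : ∑ i, ∑ k, B i k = -∑ i, ∑ k, B i k := by
        conv_lhs => rw [Finset.sum_comm]
        simp only [← Finset.sum_neg_distrib]
        exact Finset.sum_congr rfl fun i _ => Finset.sum_congr rfl fun k _ => hB k i
      linarith
    -- each of the two sums in `H' = K H + H Kᵀ`, paired with `H`, is a skew double sum
    have e1 : ∀ j, ∑ i, ∑ k, K s i k * (H s k j * H s i j) = 0 := fun j =>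
      skew _ fun i k => by rw [hK s k i]; ring
    have e2 : ∀ i, ∑ j, ∑ k, K s j k * (H s i k * H s i j) = 0 := fun i =>
      skew _ fun j k => by rw [hK s k j]; ring
    have e3 : ∑ i, ∑ j, (∑ k, K s i k * (H s k j * H s i j) +
        ∑ k, K s j k * (H s i k * H s i j)) = 0 := by
      simp only [Finset.sum_add_distrib]
      rw [Finset.sum_comm]
      simp [e1, e2]
    have e4 := congrArg (fun r => 2 * r) e3
    simp only [mul_zero] at e4
    rw [← e4, Finset.mul_sum]
    refine Finset.sum_congr rfl fun i _ => ?_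
    rw [Finset.mul_sum]
    refine Finset.sum_congr rfl fun j _ => ?_
    simp only [← mul_assoc, ← Finset.sum_mul]
    ring
  have hconst : ∀ s ∈ J, ∑ i, ∑ j, H s i j ^ 2 = 0 := by
    intro s hs
    have := hJ.is_const_of_deriv_eq_zero hJc
      (fun s hs => (hQ s hs).differentiableAt.differentiableWithinAt)
      (fun s hs => (hQ s hs).deriv) hs hs₀
    rw [this]
    simp [hH, h₀]
  intro s hs i j
  have h1 := (Finset.sum_eq_zero_iff_of_nonneg fun i _ =>
    Finset.sum_nonneg fun j _ => sq_nonneg (H s i j)).1 (hconst s hs) i (Finset.mem_univ i)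
  have h2 := (Finset.sum_eq_zero_iff_of_nonneg fun j _ => sq_nonneg (H s i j)).1 h1 j
    (Finset.mem_univ j)
  exact sub_eq_zero.1 (pow_eq_zero_iff two_ne_zero |>.1 h2)

end Gram

/-! ### The Frenet equations in a chart -/

section IteratedCoefficients

variable {n : ℕ}

theorem contDiffOn_frenetMatrix {J : Set ℝ} {κ : ℕ → ℝ → ℝ}
    (hκ : ∀ i, 1 ≤ i → i ≤ n + 1 → ContDiffOn ℝ ∞ (κ i) J) (i j : Fin (n + 2)) :
    ContDiffOn ℝ ∞ (fun s => frenetMatrix n κ s i j) J := by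
  refine ContDiffOn.sub ?_ ?_
  · split_ifs with h
    · exact hκ _ (by omega) (by omega)
    · exact contDiffOn_const
  · split_ifs with h
    · exact hκ _ (by omega) (by omega)
    · exact contDiffOn_const

/-- The components of the `k`-th iterated covariant derivative of the velocity with respect to a
frame that satisfies the Frenet equations, defined by the recursion `c_{k+1} = c_k' + c_k K`. -/
def iterVelocityCoeff (n : ℕ) (κ : ℕ → ℝ → ℝ) (J : Set ℝ) : ℕ → Fin (n + 2) → ℝ → ℝ
  | 0 => fun j _ => if j = 0 then 1 else 0
  | k + 1 => fun j s => derivWithin (iterVelocityCoeff n κ J k j) J s +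
      ∑ i, iterVelocityCoeff n κ J k i s * frenetMatrix n κ s i j

variable {J : Set ℝ} {κ : ℕ → ℝ → ℝ}

theorem contDiffOn_iterVelocityCoeff (hJ : UniqueDiffOn ℝ J)
    (hκ : ∀ i, 1 ≤ i → i ≤ n + 1 → ContDiffOn ℝ ∞ (κ i) J) (k : ℕ) (j : Fin (n + 2)) :
    ContDiffOn ℝ ∞ (iterVelocityCoeff n κ J k j) J := by
  induction k generalizing j with
  | zero => exact contDiffOn_const
  | succ k ih =>
    refine ContDiffOn.add ((ih j).derivWithin hJ (by simp)) (ContDiffOn.sum fun i _ => ?_)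
    exact (ih i).mul (contDiffOn_frenetMatrix hκ i j)

theorem iterVelocityCoeff_of_lt (k : ℕ) (j : Fin (n + 2)) (hj : k < j) (s : ℝ) :
    iterVelocityCoeff n κ J k j s = 0 := by
  induction k generalizing j s with
  | zero =>
    have : j ≠ 0 := fun h => by simp [h] at hj
    simp [iterVelocityCoeff, this]
  | succ k ih =>
    have h0 : iterVelocityCoeff n κ J k j = fun _ => 0 := funext (ih j (by omega))
    simp only [iterVelocityCoeff, h0, derivWithin_fun_const, Pi.zero_apply, zero_add]
    refine Finset.sum_eq_zero fun i _ => ?_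
    by_cases hi : k < i
    · rw [ih i hi, zero_mul]
    · have h1 : (j : ℕ) ≠ i + 1 := by omega
      have h2 : (i : ℕ) ≠ j + 1 := by omega
      simp [frenetMatrix, h1, h2]

/-- The diagonal coefficient is `κ_1 ⋯ κ_k`. -/
theorem iterVelocityCoeff_self_ne_zero {s : ℝ} (hκ : ∀ i, 1 ≤ i → i ≤ n + 1 → κ i s ≠ 0) (k : ℕ)
    (hk : k < n + 2) : iterVelocityCoeff n κ J k ⟨k, hk⟩ s ≠ 0 := by
  induction k with
  | zero => simp [iterVelocityCoeff]
  | succ k ih =>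
    have h0 : iterVelocityCoeff n κ J k ⟨k + 1, hk⟩ = fun _ => 0 :=
      funext (iterVelocityCoeff_of_lt k _ (by simp))
    simp only [iterVelocityCoeff, h0, derivWithin_fun_const, Pi.zero_apply, zero_add]
    rw [Finset.sum_eq_single ⟨k, by omega⟩]
    · refine mul_ne_zero (ih (by omega)) ?_
      have : k ≠ k + 1 + 1 := by omega
      simpa [frenetMatrix, this] using hκ (k + 1) (by omega) (by omega)
    · intro i _ hi
      have hik : (i : ℕ) ≠ k := fun h => hi (Fin.ext h)
      by_cases hi' : k < i
      · rw [iterVelocityCoeff_of_lt k i hi', zero_mul]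
      · have h1 : k + 1 ≠ i + 1 := by omega
        have h2 : (i : ℕ) ≠ k + 1 + 1 := by omega
        simp [frenetMatrix, hik.symm, h2]
    · simp

theorem isUnit_det_of_triangular {k : ℕ} {W : Type*} [AddCommGroup W] [Module ℝ W]
    (b : Module.Basis (Fin k) ℝ W) {C : Fin k → Fin k → ℝ} (h0 : ∀ i j, i < j → C i j = 0)
    (h1 : ∀ i, C i i ≠ 0) : IsUnit (b.det fun i => ∑ j, C i j • b j) := by
  have : b.toMatrix (fun i => ∑ j, C i j • b j) = (Matrix.of C).transpose := by
    ext i j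
    simp [Module.Basis.toMatrix_apply, Finsupp.single_apply]
  rw [Module.Basis.det_apply, this, Matrix.det_transpose, Matrix.det_of_isLowerTriangular,
    isUnit_iff_ne_zero]
  · exact Finset.prod_ne_zero_iff.2 fun i _ => h1 i
  · intro i j hij
    exact h0 i j hij

end IteratedCoefficients

section FrenetODE

variable {n : ℕ} {M : Type*} [TopologicalSpace M] [ChartedSpace (Model (n + 2)) M]
  [RiemannianBundle (fun p : M => TangentSpace (𝓡 (n + 2)) p)]

/-- The Frenet equations in the chart at `x₀` as an autonomous vector field. A state `(t, y, x)`
consists of the parameter, which makes the equation autonomous, the coordinates `y` of the point and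
the components `x i` of the frame. -/
def frenetField (x₀ : M) (κ : ℕ → ℝ → ℝ) (z : ℝ × Model (n + 2) × (Fin (n + 2) → Model (n + 2))) :
    ℝ × Model (n + 2) × (Fin (n + 2) → Model (n + 2)) :=
  (1, z.2.2 0, fun i => ∑ j, frenetMatrix n κ z.1 i j • z.2.2 j -
    christoffelVec x₀ z.2.1 (z.2.2 0) (z.2.2 i))

variable [IsManifold (𝓡 (n + 2)) ∞ M]
  [IsContMDiffRiemannianBundle (𝓡 (n + 2)) ∞ (Model (n + 2))
      (fun p : M => TangentSpace (𝓡 (n + 2)) p)]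

theorem contDiffOn_frenetField (x₀ : M) {κ : ℕ → ℝ → ℝ} {D : Set ℝ}
    (hκ : ∀ i, 1 ≤ i → i ≤ n + 1 → ContDiffOn ℝ ∞ (κ i) D) :
    ContDiffOn ℝ ∞ (frenetField x₀ κ) (D ×ˢ (extChartAt (𝓡 (n + 2)) x₀).target ×ˢ univ) := by
  have h1 : ContDiff ℝ ∞ fun z : ℝ × Model (n + 2) × (Fin (n + 2) → Model (n + 2)) => z.2.2 :=
    contDiff_snd.comp contDiff_snd
  have hx : ∀ i, ContDiff ℝ ∞
      fun z : ℝ × Model (n + 2) × (Fin (n + 2) → Model (n + 2)) => z.2.2 i := fun i =>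
    (contDiff_pi.1 h1) i
  have hxk : ∀ i k, ContDiff ℝ ∞
      fun z : ℝ × Model (n + 2) × (Fin (n + 2) → Model (n + 2)) => z.2.2 i k := fun i k =>
    (EuclideanSpace.proj (𝕜 := ℝ) k).contDiff.comp (hx i)
  refine ContDiffOn.prodMk contDiffOn_const (ContDiffOn.prodMk (hx 0).contDiffOn ?_)
  refine contDiffOn_pi.2 fun i => ContDiffOn.sub (ContDiffOn.sum fun j _ => ?_) ?_
  · exact ((contDiffOn_frenetMatrix hκ i j).comp contDiffOn_fst fun z hz => hz.1).smul
      (hx j).contDiffOn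
  · refine contDiffOn_euclidean.2 fun k => ?_
    simp only [christoffelVec]
    refine ContDiffOn.sum fun a _ => ContDiffOn.sum fun b _ => ?_
    refine ContDiffOn.mul (ContDiffOn.mul ?_ (hxk 0 a).contDiffOn) (hxk i b).contDiffOn
    exact (contDiffOn_christoffel x₀ k a b).comp (contDiff_fst.comp contDiff_snd).contDiffOn
      fun z hz => hz.2.1

/-- Local solutions of the Frenet equations in a chart, with prescribed initial frame. -/
theorem exists_frenet_solution (x₀ : M) {κ : ℕ → ℝ → ℝ} {s₀ δ : ℝ} (hδ : 0 < δ)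
    (hκ : ∀ i, 1 ≤ i → i ≤ n + 1 → ContDiffOn ℝ ∞ (κ i) (Ioo (s₀ - δ) (s₀ + δ)))
    {y₀ : Model (n + 2)} (hy₀ : y₀ ∈ (extChartAt (𝓡 (n + 2)) x₀).target)
    (x₁ : Fin (n + 2) → Model (n + 2)) :
    ∃ ε, 0 < ε ∧ ε ≤ δ ∧ ∃ (y : ℝ → Model (n + 2)) (x : Fin (n + 2) → ℝ → Model (n + 2)),
      y s₀ = y₀ ∧ (∀ i, x i s₀ = x₁ i) ∧
      ContDiffOn ℝ ∞ y (Ioo (s₀ - ε) (s₀ + ε)) ∧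
      (∀ i, ContDiffOn ℝ ∞ (x i) (Ioo (s₀ - ε) (s₀ + ε))) ∧
      ∀ s ∈ Ioo (s₀ - ε) (s₀ + ε), y s ∈ (extChartAt (𝓡 (n + 2)) x₀).target ∧
        HasDerivAt y (x 0 s) s ∧ ∀ i, HasDerivAt (x i)
          (∑ j, frenetMatrix n κ s i j • x j s - christoffelVec x₀ (y s) (x 0 s) (x i s)) s := by
  have hs₀ : s₀ ∈ Ioo (s₀ - δ) (s₀ + δ) := ⟨by linarith, by linarith⟩
  obtain ⟨ε₁, hε₁, α, hα₀, hαs, hα⟩ := exists_smooth_integralCurve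
    (isOpen_Ioo.prod ((isOpen_extChartAt_target x₀).prod isOpen_univ))
    (contDiffOn_frenetField x₀ hκ) (z₀ := (s₀, y₀, x₁)) ⟨hs₀, hy₀, mem_univ _⟩ s₀
  -- the first component has derivative `1`, so it is the parameter itself
  have hτ : ∀ s ∈ Ioo (s₀ - ε₁) (s₀ + ε₁), (α s).1 = s := by
    intro s hs
    have hd : ∀ t ∈ Ioo (s₀ - ε₁) (s₀ + ε₁), HasDerivAt (fun t => (α t).1 - t) 0 t := by
      intro t ht
      have h1 : HasDerivAt (fun t => (α t).1) 1 t :=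
        (hα t ht).2.fst
      simpa using h1.fun_sub (hasDerivAt_id' t)
    have := isOpen_Ioo.is_const_of_deriv_eq_zero isPreconnected_Ioo
      (fun t ht => (hd t ht).differentiableAt.differentiableWithinAt)
      (fun t ht => (hd t ht).deriv) hs (y := s₀) ⟨by linarith, by linarith⟩
    rw [hα₀] at this
    simpa [sub_eq_zero] using this
  have hsub : Ioo (s₀ - min ε₁ δ) (s₀ + min ε₁ δ) ⊆ Ioo (s₀ - ε₁) (s₀ + ε₁) :=
    Ioo_subset_Ioo (by linarith [min_le_left ε₁ δ]) (by linarith [min_le_left ε₁ δ])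
  refine ⟨min ε₁ δ, lt_min hε₁ hδ, min_le_right _ _, fun s => (α s).2.1, fun i s => (α s).2.2 i,
    by simp [hα₀], by simp [hα₀], ?_, fun i => ?_, fun s hs => ⟨(hα s (hsub hs)).1.2.1, ?_, ?_⟩⟩
  · exact (contDiff_fst.comp contDiff_snd).comp_contDiffOn (hαs.mono hsub)
  · exact contDiffOn_pi.1 ((contDiff_snd.comp contDiff_snd).comp_contDiffOn (hαs.mono hsub)) i
  · exact (hα s (hsub hs)).2.snd.fst
  · intro i
    have h2 := hasDerivAt_pi.1 (hα s (hsub hs)).2.snd.snd i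
    have h3 := hτ s (hsub hs)
    simpa [frenetField, h3] using h2

end FrenetODE

/-! ### Existence of Frenet curves -/

section Existence

variable {n : ℕ} {M : Type*} [TopologicalSpace M] [ChartedSpace (Model (n + 2)) M]
  [IsManifold (𝓡 (n + 2)) ∞ M] [RiemannianBundle (fun p : M => TangentSpace (𝓡 (n + 2)) p)]

omit [RiemannianBundle (fun p : M => TangentSpace (𝓡 (n + 2)) p)] in
theorem isSmoothAlong_ofCoord {x₀ : M} {y x : ℝ → Model (n + 2)} {J : Set ℝ}
    (hy : ContDiffOn ℝ ∞ y J) (hx : ContDiffOn ℝ ∞ x J)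
    (hmem : ∀ s ∈ J, y s ∈ (extChartAt (𝓡 (n + 2)) x₀).target) :
    IsSmoothAlong (fun s => (extChartAt (𝓡 (n + 2)) x₀).symm (y s)) J
      (fun s => ofCoord x₀ ((extChartAt (𝓡 (n + 2)) x₀).symm (y s)) (x s)) := by
  have hγ : ContMDiffOn 𝓘(ℝ, ℝ) (𝓡 (n + 2)) ∞
      (fun s => (extChartAt (𝓡 (n + 2)) x₀).symm (y s)) J :=
    (contMDiffOn_extChartAt_symm x₀).comp (contMDiffOn_iff_contDiffOn.2 hy) hmem
  intro s hs
  have hsrc : ∀ t ∈ J, (extChartAt (𝓡 (n + 2)) x₀).symm (y t) ∈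
      (extChartAt (𝓡 (n + 2)) x₀).source := fun t ht =>
    (extChartAt (𝓡 (n + 2)) x₀).map_target (hmem t ht)
  refine (contMDiffWithinAt_tangent_iff
    (γ := fun s => (extChartAt (𝓡 (n + 2)) x₀).symm (y s)) (hsrc s hs)).2 ?_
  exact ⟨hγ s hs, (hx s hs).congr (fun t ht => toCoord_ofCoord (hsrc t ht) _)
    (toCoord_ofCoord (hsrc s hs) _)⟩

/-- A curve with a frame satisfying the Frenet equations, with curvatures that vanish nowhere, is a
Frenet curve: its iterated derivatives are expressed in the frame by a triangular matrix whose
diagonal entries `κ_1 ⋯ κ_k` are nonzero. -/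
theorem isFrenetCurve_of_frame {κ : ℕ → ℝ → ℝ} {γ : ℝ → M} {J : Set ℝ}
    {X : Fin (n + 2) → (s : ℝ) → Tan (m := n + 2) (γ s)} (hJ : UniqueDiffOn ℝ J)
    (hX : ∀ i, IsSmoothAlong γ J (X i))
    (hκ : ∀ i, 1 ≤ i → i ≤ n + 1 → ContDiffOn ℝ ∞ (κ i) J)
    (hκ0 : ∀ s ∈ J, ∀ i, 1 ≤ i → i ≤ n + 1 → κ i s ≠ 0)
    (hon : ∀ s ∈ J, Orthonormal ℝ fun i => X i s)
    (hvel : ∀ s ∈ J, X 0 s = velocity γ J s)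
    (hframe : ∀ s ∈ J, ∀ i, covDerivAlong γ J (X i) s = ∑ j, frenetMatrix n κ s i j • X j s) :
    IsFrenetCurve (m := n + 2) γ J ∧ ∀ s ∈ J, Submodule.span ℝ (range fun i => X i s) =
      Submodule.span ℝ (range fun i : Fin (n + 2) => iterVelocity (m := n + 2) γ J i s) := by
  have hγ := (hX 0).base
  -- only values on `J` matter, so the derivative of each stage may be taken of its expansion
  have hiter : ∀ k, ∀ s ∈ J, iterVelocity (m := n + 2) γ J k s =
      ∑ j, iterVelocityCoeff n κ J k j s • X j s := by
    intro k
    induction k with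
    | zero =>
      intro s hs
      simp [iterVelocity, iterVelocityCoeff, ite_smul, hvel s hs]
    | succ k ih =>
      intro s hs
      change covDerivAlong γ J (iterVelocity γ J k) s = _
      rw [covDerivAlong_congr hγ ih hs, covDerivAlong_sum_smul_frame hγ hX hJ
        hframe (fun j => contDiffOn_iterVelocityCoeff hJ hκ k j) hs]
      rfl
  have hbasis : ∀ s ∈ J,
      LinearIndependent ℝ (fun i : Fin (n + 2) => iterVelocity (m := n + 2) γ J i s) ∧
      Submodule.span ℝ (range fun i : Fin (n + 2) => iterVelocity (m := n + 2) γ J i s) = ⊤ := by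
    intro s hs
    have hsp := (hon s hs).linearIndependent.span_eq_top_of_card_eq_finrank
      (by rw [finrank_tan]; simp)
    set b := Module.Basis.mk (hon s hs).linearIndependent hsp.ge with hb
    have hbX : ∀ i, b i = X i s := fun i => by rw [hb, Module.Basis.mk_apply]
    rw [Module.Basis.is_basis_iff_det b]
    have h := isUnit_det_of_triangular b (C := fun i j => iterVelocityCoeff n κ J i j s)
      (fun i j hij => iterVelocityCoeff_of_lt i j hij s)
      (fun i => iterVelocityCoeff_self_ne_zero (hκ0 s hs) i i.2)
    simp only [hbX] at h
    simpa only [hiter _ s hs] using h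
  refine ⟨⟨hγ, fun s hs => (hbasis s hs).1⟩, fun s hs => ?_⟩
  rw [(hbasis s hs).2]
  exact (hon s hs).linearIndependent.span_eq_top_of_card_eq_finrank (by rw [finrank_tan]; simp)

variable [IsContMDiffRiemannianBundle (𝓡 (n + 2)) ∞ (Model (n + 2))
      (fun p : M => TangentSpace (𝓡 (n + 2)) p)]

/-- A solution of the Frenet equations that is orthonormal at one parameter is so everywhere. -/
theorem orthonormal_of_frenet {κ : ℕ → ℝ → ℝ} {γ : ℝ → M} {J : Set ℝ} (hJ : IsOpen J)
    (hJc : IsPreconnected J) {X : Fin (n + 2) → (s : ℝ) → Tan (m := n + 2) (γ s)}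
    (hX : ∀ i, IsSmoothAlong γ J (X i))
    (hframe : ∀ s ∈ J, ∀ i, covDerivAlong γ J (X i) s = ∑ j, frenetMatrix n κ s i j • X j s)
    {s₀ : ℝ} (hs₀ : s₀ ∈ J) (h₀ : Orthonormal ℝ fun i => X i s₀) :
    ∀ s ∈ J, Orthonormal ℝ fun i => X i s := by
  intro s hs
  rw [orthonormal_iff_ite]
  refine gram_eq_one_of_skew hJ hJc (K := frenetMatrix n κ)
    (G := fun t i j => inner ℝ (X i t) (X j t)) (fun s i j => frenetMatrix_skew κ s i j) ?_ hs₀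
    (orthonormal_iff_ite.1 h₀) s hs
  intro s hs i j
  refine ((hasDerivWithinAt_inner (hX i) (hX j) hs).hasDerivAt (hJ.mem_nhds hs)).congr_deriv ?_
  rw [hframe s hs, hframe s hs, sum_inner, inner_sum]
  simp only [real_inner_smul_left, real_inner_smul_right]

/-- The existence part of the fundamental theorem of curves: there is locally a Frenet curve with
given curvatures and given positively oriented orthonormal initial frame. -/
theorem exists_frenetCurve (o : ManifoldOrientation (n + 2) M) {κ : ℕ → ℝ → ℝ} {s₀ δ : ℝ}
    (hδ : 0 < δ) (hκ : ∀ i, 1 ≤ i → i ≤ n + 1 → ContDiffOn ℝ ∞ (κ i) (Ioo (s₀ - δ) (s₀ + δ)))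
    (hpos : ∀ i, 1 ≤ i → i ≤ n → ∀ s ∈ Ioo (s₀ - δ) (s₀ + δ), 0 < κ i s)
    (hlast : ∀ s ∈ Ioo (s₀ - δ) (s₀ + δ), κ (n + 1) s ≠ 0) {p₀ : M}
    {e : Fin (n + 2) → Tan (m := n + 2) p₀} (he : Orthonormal ℝ e)
    (hepos : IsPositiveBasis (o.at_point p₀) e) :
    ∃ ε, 0 < ε ∧ ε ≤ δ ∧ ∃ (γ : ℝ → M) (X : Fin (n + 2) → (s : ℝ) → Tan (m := n + 2) (γ s)),
      (∀ i, (⟨γ s₀, X i s₀⟩ : TangentBundle (𝓡 (n + 2)) M) = ⟨p₀, e i⟩) ∧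
      IsFrenetFrame o γ (Ioo (s₀ - ε) (s₀ + ε)) X κ ∧
      IsFrenetCurve (m := n + 2) γ (Ioo (s₀ - ε) (s₀ + ε)) ∧
      IsArcLength (m := n + 2) γ (Ioo (s₀ - ε) (s₀ + ε)) := by
  have hp₀ := mem_extChartAt_source (I := 𝓡 (n + 2)) p₀
  obtain ⟨ε₁, hε₁, hε₁δ, y, x, hy₀, hx₀, hys, hxs, hode⟩ := exists_frenet_solution p₀ hδ hκ
    ((extChartAt (𝓡 (n + 2)) p₀).map_source hp₀) (fun i => toCoord p₀ p₀ (e i))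
  have hs₁ : s₀ ∈ Ioo (s₀ - ε₁) (s₀ + ε₁) := ⟨by linarith, by linarith⟩
  have hγs₀ : (extChartAt (𝓡 (n + 2)) p₀).symm (y s₀) = p₀ := by
    rw [hy₀, (extChartAt (𝓡 (n + 2)) p₀).left_inv hp₀]
  -- the chart images of the frame stay positive near `s₀`
  obtain ⟨o₀, ho₀⟩ := o.locally_constant p₀
  have hcoordpos : IsPositiveBasis o₀ fun i => x i s₀ := by
    have := (ho₀.self_of_nhds e).1 hepos
    simpa only [hx₀, mfderiv_extChartAt_apply hp₀] using this
  have hev : ∀ᶠ t in 𝓝 s₀, IsPositiveBasis o₀ (fun i => x i t) ∧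
      ∀ v : Fin (n + 2) → Tan (m := n + 2) ((extChartAt (𝓡 (n + 2)) p₀).symm (y t)),
        IsPositiveBasis (o.at_point ((extChartAt (𝓡 (n + 2)) p₀).symm (y t))) v ↔
        IsPositiveBasis (W := Model (n + 2)) o₀ (fun i => mfderiv (𝓡 (n + 2)) 𝓘(ℝ, Model (n + 2))
          (extChartAt (𝓡 (n + 2)) p₀) ((extChartAt (𝓡 (n + 2)) p₀).symm (y t)) (v i)) := by
    refine (hcoordpos.eventually fun i => ((hode s₀ hs₁).2.2 i).continuousAt).and ?_
    have hγc : Tendsto (fun t => (extChartAt (𝓡 (n + 2)) p₀).symm (y t)) (𝓝 s₀) (𝓝 p₀) := by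
      have h1 := (continuousAt_extChartAt_symm'' (I := 𝓡 (n + 2)) (hode s₀ hs₁).1).comp
        (f := y) (hode s₀ hs₁).2.1.continuousAt
      have h2 := h1.tendsto
      rwa [Function.comp_apply, hγs₀] at h2
    exact hγc.eventually ho₀
  obtain ⟨ε, hε, hεε₁, hposε⟩ := exists_forall_mem_Ioo_of_eventually hε₁ hev
  set J := Ioo (s₀ - ε) (s₀ + ε) with hJ
  have hs₀ : s₀ ∈ J := ⟨by linarith, by linarith⟩
  have hJ₁ : J ⊆ Ioo (s₀ - ε₁) (s₀ + ε₁) := Ioo_subset_Ioo (by linarith) (by linarith)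
  have hJδ : J ⊆ Ioo (s₀ - δ) (s₀ + δ) := Ioo_subset_Ioo (by linarith) (by linarith)
  have hJu : UniqueDiffOn ℝ J := isOpen_Ioo.uniqueDiffOn
  have hmem : ∀ s ∈ J, y s ∈ (extChartAt (𝓡 (n + 2)) p₀).target := fun s hs =>
    (hode s (hJ₁ hs)).1
  set γ : ℝ → M := fun s => (extChartAt (𝓡 (n + 2)) p₀).symm (y s) with hγdef
  set X : Fin (n + 2) → (s : ℝ) → Tan (m := n + 2) (γ s) := fun i s =>
    ofCoord p₀ (γ s) (x i s) with hXdef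
  have hsrc : ∀ s ∈ J, γ s ∈ (extChartAt (𝓡 (n + 2)) p₀).source := fun s hs =>
    (extChartAt (𝓡 (n + 2)) p₀).map_target (hmem s hs)
  have hext : ∀ s ∈ J, extChartAt (𝓡 (n + 2)) p₀ (γ s) = y s := fun s hs =>
    (extChartAt (𝓡 (n + 2)) p₀).right_inv (hmem s hs)
  have hXx : ∀ i, ∀ s ∈ J, toCoord p₀ (γ s) (X i s) = x i s := fun i s hs =>
    toCoord_ofCoord (hsrc s hs) _
  have hXs : ∀ i, IsSmoothAlong γ J (X i) := fun i =>
    isSmoothAlong_ofCoord (hys.mono hJ₁) ((hxs i).mono hJ₁) hmem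
  have hγ := (hXs 0).base
  have hcd : ∀ s ∈ J, derivWithin (fun t => extChartAt (𝓡 (n + 2)) p₀ (γ t)) J s = x 0 s := by
    intro s hs
    rw [derivWithin_congr hext (hext s hs)]
    exact (hode s (hJ₁ hs)).2.1.hasDerivWithinAt.derivWithin (hJu s hs)
  have hvel : ∀ s ∈ J, X 0 s = velocity γ J s := by
    intro s hs
    apply toCoord_injective (hsrc s hs)
    rw [hXx 0 s hs, toCoord_velocity ((hγ s hs).mdifferentiableWithinAt (by simp)) (hJu s hs)
      (hsrc s hs), hcd s hs]
  have hframe : ∀ s ∈ J, ∀ i, covDerivAlong γ J (X i) s =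
      ∑ j, frenetMatrix n κ s i j • X j s := by
    intro s hs i
    apply toCoord_injective (hsrc s hs)
    rw [toCoord_covDerivAlong (hXs i) hJu hs (hsrc s hs), chartCovDeriv, hcd s hs, hext s hs,
      hXx i s hs, derivWithin_congr (hXx i) (hXx i s hs),
      ((hode s (hJ₁ hs)).2.2 i).hasDerivWithinAt.derivWithin (hJu s hs), sub_add_cancel]
    simp only [map_sum, map_smul, hXx _ s hs]
  have hinit : ∀ i, (⟨γ s₀, X i s₀⟩ : TangentBundle (𝓡 (n + 2)) M) = ⟨p₀, e i⟩ := by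
    intro i
    have key : ∀ q : M, q = p₀ → (⟨q, ofCoord p₀ q (x i s₀)⟩ : TangentBundle (𝓡 (n + 2)) M) =
        ⟨p₀, e i⟩ := by
      rintro q rfl
      rw [hx₀, ofCoord_toCoord hp₀]
    exact key _ hγs₀
  have hon₀ : Orthonormal ℝ fun i => X i s₀ := by
    rw [orthonormal_iff_ite] at he ⊢
    intro i j
    rw [inner_eq_chartMetric (hsrc s₀ hs₀), hXx i s₀ hs₀, hXx j s₀ hs₀, hext s₀ hs₀, hx₀, hx₀, hy₀,
      ← inner_eq_chartMetric hp₀, he i j]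
  have hon := orthonormal_of_frenet isOpen_Ioo isPreconnected_Ioo hXs hframe hs₀ hon₀
  have hκJ : ∀ i, 1 ≤ i → i ≤ n + 1 → ContDiffOn ℝ ∞ (κ i) J := fun i h1 h2 =>
    (hκ i h1 h2).mono hJδ
  have hκ0 : ∀ s ∈ J, ∀ i, 1 ≤ i → i ≤ n + 1 → κ i s ≠ 0 := by
    intro s hs i h1 h2
    rcases Nat.lt_or_ge n i with hi | hi
    · obtain rfl : i = n + 1 := by omega
      exact hlast s (hJδ hs)
    · exact (hpos i h1 hi s (hJδ hs)).ne'
  obtain ⟨hcurve, hspan⟩ := isFrenetCurve_of_frame hJu hXs hκJ hκ0 hon hvel hframe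
  refine ⟨ε, hε, hεε₁.trans hε₁δ, γ, X, hinit, ?_, hcurve, fun s hs => ?_⟩
  · refine ⟨hXs, hκJ, fun i h1 h2 s hs => hpos i h1 h2 s (hJδ hs), hon, fun s hs => ?_, hvel,
      hspan, fun s hs => ?_, fun i s hs => ?_, fun s hs => ?_⟩
    · refine ((hposε s hs).2 _).2 ?_
      exact (congrArg (IsPositiveBasis o₀) (funext fun i =>
        (mfderiv_extChartAt_apply (hsrc s hs) _).trans (hXx i s hs))).mpr (hposε s hs).1
    · rw [hframe s hs, frenetMatrix_zero_smul κ s (fun j => X j s)]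
    · rw [hframe s hs, frenetMatrix_middle_smul κ s (fun j => X j s)]
    · rw [hframe s hs, frenetMatrix_last_smul κ s (fun j => X j s)]
  · rw [← hvel s hs]
    exact (hon s hs).1 0

end Existence

theorem CurvatureSystem.mono {n : ℕ} {I J : Set ℝ} {f θ : ℝ → ℝ} {lam κ : ℕ → ℝ → ℝ}
    (h : CurvatureSystem n I f θ lam κ) (hI : IsOpen I) (hJ : IsOpen J) (hJI : J ⊆ I) :
    CurvatureSystem n J f θ lam κ := by
  have hd : ∀ (g : ℝ → ℝ), ∀ s ∈ J, derivWithin g J s = derivWithin g I s := fun g s hs => by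
    rw [derivWithin_of_isOpen hJ hs, derivWithin_of_isOpen hI (hJI hs)]
  refine ⟨fun s hs => ?_, fun s hs => ?_, fun hn s hs => ?_, fun i h1 h2 s hs => ?_,
    fun hn s hs => ?_⟩ <;> rw [hd _ s hs]
  · exact h.eq_T s (hJI hs)
  · exact h.eq_N s (hJI hs)
  · exact h.eq_B_first hn s (hJI hs)
  · exact h.eq_B_middle i h1 h2 s (hJI hs)
  · exact h.eq_B_last hn s (hJI hs)

end

theorem theorem3p2 {n : ℕ} {M : Type*} [TopologicalSpace M] [ChartedSpace (Model (n + 2)) M]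
    [IsManifold (𝓡 (n + 2)) ∞ M] [ConnectedSpace M]
    [RiemannianBundle (fun p : M => TangentSpace (𝓡 (n + 2)) p)]
    [IsContMDiffRiemannianBundle (𝓡 (n + 2)) ∞ (Model (n + 2))
      (fun p : M => TangentSpace (𝓡 (n + 2)) p)]
    (o : ManifoldOrientation (n + 2) M) :
    -- the characterization, for a given Frenet curve
    (∀ (I : Set ℝ) (γ : ℝ → M)
      (X : Fin (n + 2) → (s : ℝ) → Tan (m := n + 2) (γ s)) (κ : ℕ → ℝ → ℝ)
      (V : (s : ℝ) → Tan (m := n + 2) (γ s)) (f : ℝ → ℝ)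
      (om : (s : ℝ) → Tan (m := n + 2) (γ s) →L[ℝ] ℝ) (θ : ℝ → ℝ),
      I.OrdConnected → I.Nontrivial →
      IsFrenetCurve (m := n + 2) γ I → IsArcLength (m := n + 2) γ I →
      IsFrenetFrame o γ I X κ →
      ContDiffOn ℝ ∞ f I →
      ((IsPACurve γ I (X 1) V θ ∧ IsTorseForming γ I V f om) ↔
        (ContDiffOn ℝ ∞ θ I ∧ (∀ s ∈ I, θ s ∈ Icc 0 Real.pi) ∧
          ∃ lam : ℕ → ℝ → ℝ,
            (∀ i ≤ n, ContDiffOn ℝ ∞ (lam i) I) ∧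
            (∀ s ∈ I, V s = frameCombination X θ lam s) ∧
            UnitCoeff n I θ lam ∧
            CurvatureSystem n I f θ lam κ ∧
            ∀ s ∈ I, om s (velocity γ I s) = -f s * inner ℝ (V s) (velocity γ I s)))) ∧
    -- the construction of the curve from prescribed curvatures
    (∀ (s₀ δ : ℝ) (p₀ : M) (e : Fin (n + 2) → Tan (m := n + 2) p₀)
      (f θ : ℝ → ℝ) (lam κ : ℕ → ℝ → ℝ),
      0 < δ → Orthonormal ℝ e → IsPositiveBasis (o.at_point p₀) e →
      ContDiffOn ℝ ∞ f (Ioo (s₀ - δ) (s₀ + δ)) →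
      ContDiffOn ℝ ∞ θ (Ioo (s₀ - δ) (s₀ + δ)) →
      (∀ s ∈ Ioo (s₀ - δ) (s₀ + δ), θ s ∈ Icc 0 Real.pi) →
      (∀ i ≤ n, ContDiffOn ℝ ∞ (lam i) (Ioo (s₀ - δ) (s₀ + δ))) →
      (∀ i, 1 ≤ i → i ≤ n + 1 → ContDiffOn ℝ ∞ (κ i) (Ioo (s₀ - δ) (s₀ + δ))) →
      (∀ i, 1 ≤ i → i ≤ n → ∀ s ∈ Ioo (s₀ - δ) (s₀ + δ), 0 < κ i s) →
      (∀ s ∈ Ioo (s₀ - δ) (s₀ + δ), κ (n + 1) s ≠ 0) →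
      UnitCoeff n (Ioo (s₀ - δ) (s₀ + δ)) θ lam →
      CurvatureSystem n (Ioo (s₀ - δ) (s₀ + δ)) f θ lam κ →
      ∃ ε, 0 < ε ∧ ε ≤ δ ∧ ∃ (γ : ℝ → M)
        (X : Fin (n + 2) → (s : ℝ) → Tan (m := n + 2) (γ s))
        (V : (s : ℝ) → Tan (m := n + 2) (γ s)),
        (∀ i, (⟨γ s₀, X i s₀⟩ : TangentBundle (𝓡 (n + 2)) M) = ⟨p₀, e i⟩) ∧
        IsFrenetFrame o γ (Ioo (s₀ - ε) (s₀ + ε)) X κ ∧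
        (∀ s ∈ Ioo (s₀ - ε) (s₀ + ε), V s = frameCombination X θ lam s) ∧
        IsPACurve γ (Ioo (s₀ - ε) (s₀ + ε)) (X 1) V θ ∧
        ∀ om : (s : ℝ) → Tan (m := n + 2) (γ s) →L[ℝ] ℝ,
          (∀ s ∈ Ioo (s₀ - ε) (s₀ + ε), om s (velocity γ (Ioo (s₀ - ε) (s₀ + ε)) s) =
            -f s * inner ℝ (V s) (velocity γ (Ioo (s₀ - ε) (s₀ + ε)) s)) →
          IsTorseForming γ (Ioo (s₀ - ε) (s₀ + ε)) V f om) := by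
  refine ⟨?_, ?_⟩
  · intro I γ X κ V f om θ hIc hIn hγ hunit hX hf
    have hI := hIc.uniqueDiffOn hIn
    constructor
    · rintro ⟨hPA, hV⟩
      obtain ⟨lam, h1, h2, h3, h4⟩ := exists_frameCoeff_of_isTorseForming hI hX hPA hV
      exact ⟨hPA.smooth_angle, hPA.angle_mem, lam, h1, h2, h3, h4, fun s hs =>
        form_velocity_eq_of_isTorseForming hI hV hPA.unit hs⟩
    · rintro ⟨hθ, hθI, lam, hlam, hV, hcoef, hsys, hom⟩
      exact ⟨isPACurve_of_eq_frameCombination hγ hunit hX hθ hθI hlam hV hcoef,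
        isTorseForming_of_curvatureSystem hI hX hf hθ hlam hV hsys hom⟩
  · intro s₀ δ p₀ e f θ lam κ hδ he hepos hf hθ hθI hlam hκ hpos hlast hcoef hsys
    obtain ⟨ε, hε, hεδ, γ, X, hinit, hX, hγ, hunit⟩ :=
      exists_frenetCurve o hδ hκ hpos hlast he hepos
    have hJ : Ioo (s₀ - ε) (s₀ + ε) ⊆ Ioo (s₀ - δ) (s₀ + δ) :=
      Ioo_subset_Ioo (by linarith) (by linarith)
    have hlamJ : ∀ i ≤ n, ContDiffOn ℝ ∞ (lam i) (Ioo (s₀ - ε) (s₀ + ε)) := fun i hi =>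
      (hlam i hi).mono hJ
    refine ⟨ε, hε, hεδ, γ, X, frameCombination X θ lam, hinit, hX, fun s _ => rfl, ?_,
      fun om hom => ?_⟩
    · exact isPACurve_of_eq_frameCombination hγ hunit hX (hθ.mono hJ) (fun s hs => hθI s (hJ hs))
        hlamJ (fun s _ => rfl) fun s hs => hcoef s (hJ hs)
    · exact isTorseForming_of_curvatureSystem isOpen_Ioo.uniqueDiffOn hX (hf.mono hJ)
        (hθ.mono hJ) hlamJ (fun s _ => rfl) (hsys.mono isOpen_Ioo isOpen_Ioo hJ) hom
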